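/- Let $\mathbb T=\mathbb R/\mathbb Z$ with Lebesgue measure, and let functions on $\mathbb T$ be real- or complex-valued. For $f\in L^1(\mathbb T)$ and an integer $k\ge 0$ put $$\mathbb E_kf(x)=2^k\int_{m2^{-k}}^{(m+1)2^{-k}}f(t)\,dt\quad\text{for } m2^{-k}\le x<(m+1)2^{-k},\ m=0,\dots,2^k-1,$$ and $\mathbb D_0f=\mathbb E_0f$, $\mathbb D_kf=\mathbb E_kf-\mathbb E_{k-1}f$ for $k\ge1$. For $\gamma>1/2$ let $LG^\gamma_{\mathrm{dyad}}(\mathbb T)$ be the space of all $f\in L^1(\mathbb T)$ with $$\|f\|_{LG^\gamma_{\mathrm{dyad}}}=\sup_{k\ge0}(k+1)^\gamma\|\mathbb D_kf\|_\infty<\infty,$$ and for $\nu>0$ let $\exp L^\nu(\mathbb T)$ be the space of all $f\in L^1(\mathbb T)$ with $$\|f\|_{\exp L^\nu}=\sup_{1\le p<\infty}p^{-1/\nu}\|f\|_{L^p(\mathbb T)}<\infty.$$ For a normed space $Y$ embedded in a normed space $X$ and an integer $n\ge1$, the entropy number $e_n(Y;X)$ is the infimum of all $\varepsilon>0$ for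 which there are $2^{n-1}$ balls of radius $\varepsilon$ in $X$ that cover the image of the unit ball $\{y\in Y:\|y\|_Y\le1\}$ in $X$. **Proposition.** Let $\nu>0$, and suppose that either $\gamma>1/2$ and $\nu<2$, or $\nu\ge2$ and $\gamma>1-1/\nu$. Then $LG^\gamma_{\mathrm{dyad}}(\mathbb T)\subset\exp L^\nu(\mathbb T)$, the embedding $LG^\gamma_{\mathrm{dyad}}(\mathbb T)\to\exp L^\nu(\mathbb T)$ is a compact operator, and there is a constant $C=C(\gamma,\nu)$ such that for all integers $n\ge2$ $$e_n(LG^\gamma_{\mathrm{dyad}};\exp L^\nu)\le C(\log n)^{1/2-\gamma}\quad\text{if }\gamma>1/2,\ \nu\le2,$$ $$e_n(LG^\gamma_{\mathrm{dyad}};\exp L^\nu)\le C(\log n)^{1-\gamma-1/\nu}\quad\text{if }\gamma>1-1/\nu,\ \nu\ge2.$$ -/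

import Mathlib

open MeasureTheory
open scoped ENNReal

noncomputable section

/-- `L¹(𝕋)` for the torus `𝕋 = ℝ/ℤ` with normalized Lebesgue measure; `𝕜` is `ℝ` or `ℂ`. -/
abbrev L1Torus (𝕜 : Type*) [RCLike 𝕜] : Type _ :=
  Lp 𝕜 1 (volume : Measure UnitAddCircle)

section DyadicOperators

variable {𝕜 : Type*} [RCLike 𝕜]

/-- The representative in `[0, 1)` of a point of the torus. -/
def torusRep (x : UnitAddCircle) : ℝ := (AddCircle.equivIco (1 : ℝ) 0 x : ℝ)

/-- The conditional expectation `𝔼_k f(x) = 2^k ∫_{m 2^{-k}}^{(m+1) 2^{-k}} f(t) dt`, where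
`[m 2^{-k}, (m+1) 2^{-k})` is the dyadic interval of length `2^{-k}` that contains the
representative of `x` in `[0, 1)`, that is, `m = ⌊2^k x⌋`. -/
def dyadicE (k : ℕ) (f : UnitAddCircle → 𝕜) (x : UnitAddCircle) : 𝕜 :=
  (2 : ℝ) ^ k •
    ∫ t in ((⌊(2 : ℝ) ^ k * torusRep x⌋ : ℝ) / 2 ^ k)..((⌊(2 : ℝ) ^ k * torusRep x⌋ + 1 : ℝ) / 2 ^ k),
      f (t : UnitAddCircle)

/-- The martingale differences `𝔻_0 = 𝔼_0`, `𝔻_k = 𝔼_k - 𝔼_{k-1}` for `k ≥ 1`. -/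
def dyadicD (k : ℕ) (f : UnitAddCircle → 𝕜) (x : UnitAddCircle) : 𝕜 :=
  match k with
  | 0 => dyadicE 0 f x
  | k + 1 => dyadicE (k + 1) f x - dyadicE k f x

end DyadicOperators

section Norms

variable {𝕜 : Type*} [RCLike 𝕜]

/-- `sup_{k ≥ 0} (k+1)^γ ‖𝔻_k f‖_∞`, as an extended nonnegative number. -/
def eLGdyadNorm (γ : ℝ) (f : UnitAddCircle → 𝕜) : ℝ≥0∞ :=
  ⨆ k : ℕ, ENNReal.ofReal (((k : ℝ) + 1) ^ γ) * eLpNorm (dyadicD k f) ∞ volume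

/-- `sup_{1 ≤ p < ∞} p^{-1/ν} ‖f‖_{L^p(𝕋)}`, as an extended nonnegative number. -/
def eExpLNorm (ν : ℝ) (f : UnitAddCircle → 𝕜) : ℝ≥0∞ :=
  ⨆ (p : ℝ) (_ : 1 ≤ p), ENNReal.ofReal (p ^ (-1 / ν)) * eLpNorm f (ENNReal.ofReal p) volume

/-! Linearity of the dyadic operators and the seminorm properties. -/

lemma torusRep_nonneg (x : UnitAddCircle) : 0 ≤ torusRep x :=
  (AddCircle.equivIco (1 : ℝ) 0 x).2.1

lemma torusRep_lt_one (x : UnitAddCircle) : torusRep x < 1 := by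
  have h := (AddCircle.equivIco (1 : ℝ) 0 x).2.2
  simpa [torusRep] using h

lemma dyadic_uIoc_subset (k : ℕ) (x : UnitAddCircle) :
    Set.uIoc ((⌊(2 : ℝ) ^ k * torusRep x⌋ : ℝ) / 2 ^ k)
      ((⌊(2 : ℝ) ^ k * torusRep x⌋ + 1 : ℝ) / 2 ^ k) ⊆ Set.Ioc 0 (0 + 1) := by
  have h2 : (0 : ℝ) < 2 ^ k := by positivity
  rw [Set.uIoc_of_le (by gcongr; linarith)]
  apply Set.Ioc_subset_Ioc
  · have : 0 ≤ ⌊(2 : ℝ) ^ k * torusRep x⌋ :=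
      Int.floor_nonneg.2 (mul_nonneg h2.le (torusRep_nonneg x))
    positivity
  · have h1 : ⌊(2 : ℝ) ^ k * torusRep x⌋ < ((2 ^ k : ℕ) : ℤ) := by
      rw [Int.floor_lt]
      push_cast
      nlinarith [torusRep_lt_one x]
    have h3 : ⌊(2 : ℝ) ^ k * torusRep x⌋ + 1 ≤ ((2 ^ k : ℕ) : ℤ) := h1
    have h4 : ((⌊(2 : ℝ) ^ k * torusRep x⌋ : ℝ) + 1) ≤ 2 ^ k := by exact_mod_cast h3
    rw [zero_add, div_le_one h2]
    exact h4

lemma dyadic_ae_eq {E : Type*} {f g : UnitAddCircle → E} (h : f =ᵐ[volume] g) :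
    ∀ᵐ t : ℝ ∂(volume.restrict (Set.Ioc (0 : ℝ) (0 + 1))),
      f (t : UnitAddCircle) = g (t : UnitAddCircle) :=
  (UnitAddCircle.measurePreserving_mk 0).quasiMeasurePreserving.ae_eq_comp h

lemma dyadicE_congr {f g : UnitAddCircle → 𝕜} (h : f =ᵐ[volume] g) (k : ℕ) (x : UnitAddCircle) :
    dyadicE k f x = dyadicE k g x := by
  unfold dyadicE
  congr 1
  apply intervalIntegral.integral_congr_ae_restrict
  exact ae_restrict_of_ae_restrict_of_subset (dyadic_uIoc_subset k x) (dyadic_ae_eq h)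

lemma dyadic_intervalIntegrable {f : UnitAddCircle → 𝕜} (hf : Integrable f volume) (k : ℕ)
    (x : UnitAddCircle) :
    IntervalIntegrable (fun t : ℝ => f (t : UnitAddCircle)) volume
      ((⌊(2 : ℝ) ^ k * torusRep x⌋ : ℝ) / 2 ^ k)
      ((⌊(2 : ℝ) ^ k * torusRep x⌋ + 1 : ℝ) / 2 ^ k) := by
  rw [intervalIntegrable_iff]
  have h : IntegrableOn (fun t : ℝ => f (t : UnitAddCircle)) (Set.Ioc (0 : ℝ) (0 + 1)) volume :=
    ((UnitAddCircle.measurePreserving_mk 0).integrable_comp hf.aestronglyMeasurable).2 hf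
  exact h.mono_set (dyadic_uIoc_subset k x)

lemma dyadicE_add {f g : UnitAddCircle → 𝕜} (hf : Integrable f volume) (hg : Integrable g volume)
    (k : ℕ) (x : UnitAddCircle) : dyadicE k (f + g) x = dyadicE k f x + dyadicE k g x := by
  unfold dyadicE
  rw [← smul_add, ← intervalIntegral.integral_add (dyadic_intervalIntegrable hf k x)
    (dyadic_intervalIntegrable hg k x)]
  rfl

lemma dyadicE_smul (c : 𝕜) (f : UnitAddCircle → 𝕜) (k : ℕ) (x : UnitAddCircle) :
    dyadicE k (c • f) x = c • dyadicE k f x := by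
  unfold dyadicE
  rw [smul_comm c]
  congr 1
  exact intervalIntegral.integral_smul c _

lemma dyadicD_congr {f g : UnitAddCircle → 𝕜} (h : f =ᵐ[volume] g) (k : ℕ) :
    dyadicD k f = dyadicD k g := by
  funext x
  cases k <;> simp only [dyadicD, dyadicE_congr h]

lemma dyadicD_add {f g : UnitAddCircle → 𝕜} (hf : Integrable f volume) (hg : Integrable g volume)
    (k : ℕ) : dyadicD k (f + g) = dyadicD k f + dyadicD k g := by
  funext x
  cases k <;> simp only [dyadicD, dyadicE_add hf hg, Pi.add_apply]
  ring

lemma dyadicD_smul (c : 𝕜) (f : UnitAddCircle → 𝕜) (k : ℕ) :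
    dyadicD k (c • f) = c • dyadicD k f := by
  funext x
  cases k <;> simp only [dyadicD, dyadicE_smul, Pi.smul_apply, smul_sub]

lemma eLGdyadNorm_add_le (γ : ℝ) (f g : L1Torus 𝕜) :
    eLGdyadNorm γ (f + g : L1Torus 𝕜) ≤ eLGdyadNorm γ f + eLGdyadNorm γ g := by
  refine iSup_le fun k => ?_
  rw [dyadicD_congr (Lp.coeFn_add f g),
    dyadicD_add (L1.integrable_coeFn f) (L1.integrable_coeFn g)]
  refine le_trans ?_ (add_le_add (le_iSup _ k) (le_iSup _ k))
  rw [← mul_add]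
  gcongr
  simp only [eLpNorm_exponent_top]
  exact eLpNormEssSup_add_le

lemma eLGdyadNorm_smul (γ : ℝ) (c : 𝕜) (f : L1Torus 𝕜) :
    eLGdyadNorm γ (c • f : L1Torus 𝕜) = ‖c‖ₑ * eLGdyadNorm γ f := by
  unfold eLGdyadNorm
  rw [ENNReal.mul_iSup]
  congr 1
  funext k
  rw [dyadicD_congr (Lp.coeFn_smul c f), dyadicD_smul, eLpNorm_const_smul]
  ring

lemma eExpLNorm_add_le (ν : ℝ) (f g : L1Torus 𝕜) :
    eExpLNorm ν (f + g : L1Torus 𝕜) ≤ eExpLNorm ν f + eExpLNorm ν g := by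
  refine iSup₂_le fun p hp => ?_
  rw [eLpNorm_congr_ae (Lp.coeFn_add f g)]
  refine le_trans ?_ (add_le_add (le_iSup₂ p hp) (le_iSup₂ p hp))
  rw [← mul_add]
  gcongr
  exact eLpNorm_add_le (Lp.aestronglyMeasurable f) (Lp.aestronglyMeasurable g)
    (by simpa using hp)

lemma eExpLNorm_smul (ν : ℝ) (c : 𝕜) (f : L1Torus 𝕜) :
    eExpLNorm ν (c • f : L1Torus 𝕜) = ‖c‖ₑ * eExpLNorm ν f := by
  unfold eExpLNorm
  simp_rw [ENNReal.mul_iSup]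
  refine iSup_congr fun p => iSup_congr fun _ => ?_
  rw [eLpNorm_congr_ae (Lp.coeFn_smul c f), eLpNorm_const_smul]
  ring

lemma eLpNorm_one_le_eExpLNorm (ν : ℝ) (f : UnitAddCircle → 𝕜) :
    eLpNorm f 1 volume ≤ eExpLNorm ν f := by
  refine le_trans ?_ (le_iSup₂ (1 : ℝ) le_rfl)
  simp

end Norms

section Spaces

variable (𝕜 : Type*) [RCLike 𝕜]

/-- The `f ∈ L¹(𝕋)` with `sup_k (k+1)^γ ‖𝔻_k f‖_∞ < ∞`. -/
def lgDyadSubmodule (γ : ℝ) : Submodule 𝕜 (L1Torus 𝕜) where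
  carrier := {f | eLGdyadNorm γ f < ∞}
  add_mem' {f g} hf hg := (eLGdyadNorm_add_le γ f g).trans_lt (ENNReal.add_lt_top.2 ⟨hf, hg⟩)
  zero_mem' := by
    have h := eLGdyadNorm_smul γ (0 : 𝕜) (0 : L1Torus 𝕜)
    rw [zero_smul, enorm_zero, zero_mul] at h
    exact h.trans_lt ENNReal.zero_lt_top
  smul_mem' c f hf := by
    change eLGdyadNorm γ (c • f : L1Torus 𝕜) < ∞
    rw [eLGdyadNorm_smul]
    exact ENNReal.mul_lt_top enorm_lt_top hf

/-- The `f ∈ L¹(𝕋)` with `sup_{1 ≤ p < ∞} p^{-1/ν} ‖f‖_p < ∞`. -/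
def expLSubmodule (ν : ℝ) : Submodule 𝕜 (L1Torus 𝕜) where
  carrier := {f | eExpLNorm ν f < ∞}
  add_mem' {f g} hf hg := (eExpLNorm_add_le ν f g).trans_lt (ENNReal.add_lt_top.2 ⟨hf, hg⟩)
  zero_mem' := by
    have h := eExpLNorm_smul ν (0 : 𝕜) (0 : L1Torus 𝕜)
    rw [zero_smul, enorm_zero, zero_mul] at h
    exact h.trans_lt ENNReal.zero_lt_top
  smul_mem' c f hf := by
    change eExpLNorm ν (c • f : L1Torus 𝕜) < ∞
    rw [eExpLNorm_smul]
    exact ENNReal.mul_lt_top enorm_lt_top hf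

/-- The class `LG^γ_dyad(𝕋)`, normed by `sup_k (k+1)^γ ‖𝔻_k f‖_∞` (and not by the `L¹` norm). -/
def LGdyad (γ : ℝ) : Type _ := lgDyadSubmodule 𝕜 γ

/-- The space `exp L^ν(𝕋)`, normed by `sup_{1 ≤ p < ∞} p^{-1/ν} ‖f‖_p` (and not by the
`L¹` norm). -/
def ExpL (ν : ℝ) : Type _ := expLSubmodule 𝕜 ν

instance (γ : ℝ) : AddCommGroup (LGdyad 𝕜 γ) :=
  inferInstanceAs (AddCommGroup (lgDyadSubmodule 𝕜 γ))

instance (γ : ℝ) : Module 𝕜 (LGdyad 𝕜 γ) :=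
  inferInstanceAs (Module 𝕜 (lgDyadSubmodule 𝕜 γ))

instance (ν : ℝ) : AddCommGroup (ExpL 𝕜 ν) :=
  inferInstanceAs (AddCommGroup (expLSubmodule 𝕜 ν))

instance (ν : ℝ) : Module 𝕜 (ExpL 𝕜 ν) :=
  inferInstanceAs (Module 𝕜 (expLSubmodule 𝕜 ν))

variable {𝕜}

/-- The underlying `L¹` function of an element of `LG^γ_dyad(𝕋)`. -/
def LGdyad.toL1 {γ : ℝ} : LGdyad 𝕜 γ →ₗ[𝕜] L1Torus 𝕜 := (lgDyadSubmodule 𝕜 γ).subtype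

/-- The underlying `L¹` function of an element of `exp L^ν(𝕋)`. -/
def ExpL.toL1 {ν : ℝ} : ExpL 𝕜 ν →ₗ[𝕜] L1Torus 𝕜 := (expLSubmodule 𝕜 ν).subtype

lemma LGdyad.eNorm_lt_top {γ : ℝ} (f : LGdyad 𝕜 γ) : eLGdyadNorm γ f.toL1 < ∞ := f.2

lemma ExpL.eNorm_lt_top {ν : ℝ} (f : ExpL 𝕜 ν) : eExpLNorm ν f.toL1 < ∞ := f.2

instance (γ : ℝ) : Norm (LGdyad 𝕜 γ) := ⟨fun f => (eLGdyadNorm γ f.toL1).toReal⟩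

instance (ν : ℝ) : Norm (ExpL 𝕜 ν) := ⟨fun f => (eExpLNorm ν f.toL1).toReal⟩

lemma LGdyad.norm_def {γ : ℝ} (f : LGdyad 𝕜 γ) : ‖f‖ = (eLGdyadNorm γ f.toL1).toReal := rfl

lemma ExpL.norm_def {ν : ℝ} (f : ExpL 𝕜 ν) : ‖f‖ = (eExpLNorm ν f.toL1).toReal := rfl

lemma LGdyad.core (γ : ℝ) : SeminormedSpace.Core 𝕜 (LGdyad 𝕜 γ) where
  norm_nonneg _ := ENNReal.toReal_nonneg
  norm_smul c f := by
    rw [LGdyad.norm_def, LGdyad.norm_def, map_smul, eLGdyadNorm_smul, ENNReal.toReal_mul,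
      toReal_enorm]
  norm_triangle f g := by
    rw [LGdyad.norm_def, LGdyad.norm_def, LGdyad.norm_def, map_add,
      ← ENNReal.toReal_add f.eNorm_lt_top.ne g.eNorm_lt_top.ne]
    exact ENNReal.toReal_mono (ENNReal.add_lt_top.2 ⟨f.eNorm_lt_top, g.eNorm_lt_top⟩).ne
      (eLGdyadNorm_add_le γ _ _)

lemma ExpL.core (ν : ℝ) : NormedSpace.Core 𝕜 (ExpL 𝕜 ν) where
  norm_nonneg _ := ENNReal.toReal_nonneg
  norm_smul c f := by
    rw [ExpL.norm_def, ExpL.norm_def, map_smul, eExpLNorm_smul, ENNReal.toReal_mul,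
      toReal_enorm]
  norm_triangle f g := by
    rw [ExpL.norm_def, ExpL.norm_def, ExpL.norm_def, map_add,
      ← ENNReal.toReal_add f.eNorm_lt_top.ne g.eNorm_lt_top.ne]
    exact ENNReal.toReal_mono (ENNReal.add_lt_top.2 ⟨f.eNorm_lt_top, g.eNorm_lt_top⟩).ne
      (eExpLNorm_add_le ν _ _)
  norm_eq_zero_iff f := by
    constructor
    · intro h
      rw [ExpL.norm_def, ENNReal.toReal_eq_zero_iff] at h
      have h0 : eExpLNorm ν f.toL1 = 0 := h.resolve_right f.eNorm_lt_top.ne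
      have h1 : eLpNorm f.toL1 1 volume = 0 :=
        le_antisymm ((eLpNorm_one_le_eExpLNorm ν _).trans h0.le) zero_le
      have h2 : f.toL1 = 0 := by
        rw [← norm_eq_zero, Lp.norm_def, h1, ENNReal.toReal_zero]
      exact Subtype.ext h2
    · rintro rfl
      have h := eExpLNorm_smul ν (0 : 𝕜) (0 : L1Torus 𝕜)
      rw [zero_smul, enorm_zero, zero_mul] at h
      rw [ExpL.norm_def, map_zero, h, ENNReal.toReal_zero]

instance (γ : ℝ) : SeminormedAddCommGroup (LGdyad 𝕜 γ) :=
  SeminormedAddCommGroup.ofCore (LGdyad.core (𝕜 := 𝕜) γ)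

instance (ν : ℝ) : NormedAddCommGroup (ExpL 𝕜 ν) :=
  NormedAddCommGroup.ofCore (ExpL.core (𝕜 := 𝕜) ν)

instance (γ : ℝ) : NormedSpace 𝕜 (LGdyad 𝕜 γ) where
  norm_smul_le c f := ((LGdyad.core (𝕜 := 𝕜) γ).norm_smul c f).le

instance (ν : ℝ) : NormedSpace 𝕜 (ExpL 𝕜 ν) where
  norm_smul_le c f := ((ExpL.core (𝕜 := 𝕜) ν).norm_smul c f).le

end Spaces

/-- The `n`-th entropy number (`n ≥ 1`) of an embedding `ι : Y → X`: the infimum of the `ε > 0`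
for which `2^(n-1)` balls of radius `ε` in `X` cover the image of the unit ball of `Y`.
It is `∞` if there is no such `ε`. -/
def entropyNumber {Y X : Type*} [SeminormedAddCommGroup Y] [SeminormedAddCommGroup X]
    (ι : Y → X) (n : ℕ) : ℝ≥0∞ :=
  ⨅ (ε : ℝ) (_ : 0 < ε)
    (_ : ∃ c : Fin (2 ^ (n - 1)) → X, ∀ y : Y, ‖y‖ ≤ 1 → ∃ i, ι y ∈ Metric.closedBall (c i) ε),
    ENNReal.ofReal ε

end

open MeasureTheory
open scoped ENNReal

noncomputable section

section DyadicCells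

/-! ### The dyadic cells of the torus -/

/-! Put `μ = max ν 2` and `a = γ - 1 + 1/μ`, which is positive. The `exp L^ν` norm is at most the
`exp L^μ` norm, so both regimes follow from one tail estimate: for `f` in the unit ball, `f - 𝔼_N f`
has `exp L^μ` norm `O((N+1)^(-a))` (`exists_eExpLNorm_sub_dyadicE_le`).

Two bounds give this estimate. Dyadic martingales are sub-Gaussian, hence `‖f - 𝔼_M f‖_p ≲ √p
(∑_{k>M} (k+1)^(-2γ))^(1/2) ≲ √p (M+1)^(1/2-γ)`, which is good enough when `p ≤ M+1`. For `p ≥ N+1`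
one passes to the generation `M = ⌊p⌋`. The Gaussian bound handles `f - 𝔼_M f`, and `𝔼_M f - 𝔼_N f`
is bounded uniformly by the sum of its increments, a sum which the weight `p^(-1/μ)` compensates.

It remains to discretize `𝔼_N f`. It consists of `2^N` averages of modulus at most `N+1`, and
rounding them to accuracy of order `2^(-N)` takes at most `2^(4·4^N)` codes. Functions with the same
code differ by `O((N+1)^(-a))` in `exp L^ν` (`exists_cover`). With `2^(n-1)` balls available one may
take `N` comparable to `log n`, so this wasteful count costs only a constant. Letting `N → ∞` gives
total boundedness, and compactness follows because `exp L^ν` is complete. -/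

lemma coe_torusRep (x : UnitAddCircle) : ((torusRep x : ℝ) : UnitAddCircle) = x :=
  (AddCircle.equivIco (1 : ℝ) 0).symm_apply_apply x

lemma torusRep_coe {t : ℝ} (ht : t ∈ Set.Ico (0 : ℝ) 1) : torusRep (t : UnitAddCircle) = t := by
  have ht' : t ∈ Set.Ico (0 : ℝ) (0 + 1) := by simpa using ht
  have h := (AddCircle.equivIco (1 : ℝ) 0).apply_symm_apply ⟨t, ht'⟩
  exact congrArg Subtype.val h

lemma measurable_torusRep : Measurable torusRep :=
  measurable_subtype_coe.comp (AddCircle.measurableEquivIco (1 : ℝ) 0).measurable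

/-- `torusRep` takes values in `[0, 1)`. The target is written with `Ioc` to agree with the quotient
map; the two intervals differ by a null set. -/
lemma measurePreserving_torusRep :
    MeasurePreserving torusRep volume (volume.restrict (Set.Ioc (0 : ℝ) 1)) := by
  refine ⟨measurable_torusRep, ?_⟩
  have hmk := UnitAddCircle.measurePreserving_mk 0
  rw [← hmk.map_eq, Measure.map_map measurable_torusRep hmk.measurable, zero_add]
  have h : torusRep ∘ (fun t : ℝ => (t : UnitAddCircle))
      =ᵐ[volume.restrict (Set.Ioc (0 : ℝ) 1)] id := by
    rw [Filter.EventuallyEq, ← MeasureTheory.restrict_Ico_eq_restrict_Ioc,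
      ae_restrict_iff' measurableSet_Ico]
    exact .of_forall fun t ht => torusRep_coe ht
  exact (Measure.map_congr h).trans Measure.map_id

/-- The index `⌊2^k x⌋` of the dyadic cell of generation `k` that contains `x`. -/
def dyadicIndex (k : ℕ) (x : UnitAddCircle) : ℕ := ⌊(2 : ℝ) ^ k * torusRep x⌋₊

lemma measurable_dyadicIndex (k : ℕ) : Measurable (dyadicIndex k) :=
  Nat.measurable_floor.comp (measurable_torusRep.const_mul _)

lemma dyadicIndex_lt (k : ℕ) (x : UnitAddCircle) : dyadicIndex k x < 2 ^ k := by
  have h0 := torusRep_nonneg x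
  have h2 : (0 : ℝ) < 2 ^ k := by positivity
  rw [dyadicIndex, Nat.floor_lt (by positivity)]
  push_cast
  nlinarith [torusRep_lt_one x]

/-- Removing the last `j` binary digits of an index gives the ancestor `j` generations up. This
turns the martingale structure into arithmetic of indices. -/
lemma dyadicIndex_div (k j : ℕ) (x : UnitAddCircle) :
    dyadicIndex (k + j) x / 2 ^ j = dyadicIndex k x := by
  have h := Nat.floor_div_natCast ((2 : ℝ) ^ (k + j) * torusRep x) (2 ^ j)
  rw [dyadicIndex, ← h, dyadicIndex]
  congr 1
  push_cast
  rw [pow_add]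
  field_simp

lemma volume_dyadicIndex_preimage {k m : ℕ} (hm : m < 2 ^ k) :
    volume (dyadicIndex k ⁻¹' {m}) = ((2 : ℝ≥0∞) ^ k)⁻¹ := by
  have h2 : (0 : ℝ) < 2 ^ k := by positivity
  have hm' : (m : ℝ) + 1 ≤ 2 ^ k := by exact_mod_cast hm
  set g : ℝ → ℕ := fun t => ⌊(2 : ℝ) ^ k * t⌋₊
  have hg : MeasurableSet (g ⁻¹' {m}) :=
    (Nat.measurable_floor.comp (measurable_const_mul _)) (measurableSet_singleton m)
  have h1 : dyadicIndex k ⁻¹' {m} = torusRep ⁻¹' (g ⁻¹' {m}) := rfl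
  rw [h1, measurePreserving_torusRep.measure_preimage hg.nullMeasurableSet,
    ← restrict_Ico_eq_restrict_Ioc, Measure.restrict_apply hg]
  have h3 : g ⁻¹' {m} ∩ Set.Ico (0 : ℝ) 1 = Set.Ico ((m : ℝ) / 2 ^ k) ((m + 1) / 2 ^ k) := by
    ext t
    simp only [Set.mem_inter_iff, Set.mem_preimage, Set.mem_singleton_iff, Set.mem_Ico, g]
    rw [div_le_iff₀ h2, lt_div_iff₀ h2]
    constructor
    · rintro ⟨h, h0, -⟩
      rw [Nat.floor_eq_iff (by positivity)] at h
      constructor <;> linarith [h.1, h.2]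
    · rintro ⟨ha, hb⟩
      have h0 : 0 ≤ t := by
        by_contra hc
        have : t * 2 ^ k < 0 := mul_neg_of_neg_of_pos (not_le.1 hc) h2
        have : (0 : ℝ) ≤ m := by positivity
        linarith
      refine ⟨?_, h0, ?_⟩
      · rw [Nat.floor_eq_iff (by positivity)]
        constructor <;> linarith
      · by_contra hc
        have : 1 * (2 : ℝ) ^ k ≤ t * 2 ^ k := by gcongr; exact not_lt.1 hc
        linarith
  rw [h3, Real.volume_Ico, show ((m : ℝ) + 1) / 2 ^ k - m / 2 ^ k = (2 ^ k)⁻¹ by field_simp; ring,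
    ENNReal.ofReal_inv_of_pos h2, ENNReal.ofReal_pow (by norm_num)]
  simp

lemma lintegral_comp_dyadicIndex (k : ℕ) (G : ℕ → ℝ≥0∞) :
    ∫⁻ x, G (dyadicIndex k x) = ((2 : ℝ≥0∞) ^ k)⁻¹ * ∑ m ∈ Finset.range (2 ^ k), G m := by
  rw [← lintegral_map (measurable_of_countable G) (measurable_dyadicIndex k),
    lintegral_countable', tsum_eq_sum (s := Finset.range (2 ^ k)), Finset.mul_sum]
  · refine Finset.sum_congr rfl fun m hm => ?_
    rw [Measure.map_apply (measurable_dyadicIndex k) (measurableSet_singleton m),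
      volume_dyadicIndex_preimage (Finset.mem_range.1 hm), mul_comm]
  · intro m hm
    rw [Measure.map_apply (measurable_dyadicIndex k) (measurableSet_singleton m)]
    have : dyadicIndex k ⁻¹' {m} = ∅ := by
      ext x
      simp only [Set.mem_preimage, Set.mem_singleton_iff, Set.mem_empty_iff_false, iff_false]
      rintro rfl
      exact hm (Finset.mem_range.2 (dyadicIndex_lt k x))
    simp [this]

/-- Every cell has positive measure, so a property of cells that holds almost everywhere holds for
each cell. Essential-sup bounds on `𝔻_k f` thereby become bounds at every point. -/
lemma of_ae_comp_dyadicIndex {k : ℕ} {P : ℕ → Prop} (h : ∀ᵐ x, P (dyadicIndex k x)) {m : ℕ}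
    (hm : m < 2 ^ k) : P m := by
  by_contra hP
  have h0 : volume (dyadicIndex k ⁻¹' {m}) = 0 :=
    measure_mono_null (fun x (hx : dyadicIndex k x = m) => by simpa [hx] using hP) h
  rw [volume_dyadicIndex_preimage hm] at h0
  simp at h0

end DyadicCells

section DyadicAverages

/-! ### Averages over dyadic cells -/

variable {𝕜 : Type*} [RCLike 𝕜]

/-- The average of `f` over the `m`-th dyadic cell of generation `k`. -/
def dyadicAvg (f : UnitAddCircle → 𝕜) (k m : ℕ) : 𝕜 :=
  (2 : ℝ) ^ k • ∫ t in ((m : ℝ) / 2 ^ k)..((m + 1 : ℝ) / 2 ^ k), f (t : UnitAddCircle)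

lemma dyadicE_eq_dyadicAvg (f : UnitAddCircle → 𝕜) (k : ℕ) (x : UnitAddCircle) :
    dyadicE k f x = dyadicAvg f k (dyadicIndex k x) := by
  have h0 : 0 ≤ (2 : ℝ) ^ k * torusRep x := mul_nonneg (by positivity) (torusRep_nonneg x)
  have h : ((⌊(2 : ℝ) ^ k * torusRep x⌋ : ℤ) : ℝ) = (dyadicIndex k x : ℝ) := by
    rw [dyadicIndex, natCast_floor_eq_intCast_floor h0]
  rw [dyadicE, dyadicAvg, h]

lemma measurable_dyadicE (f : UnitAddCircle → 𝕜) (k : ℕ) : Measurable (dyadicE k f) := by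
  have : dyadicE k f = dyadicAvg f k ∘ dyadicIndex k := funext (dyadicE_eq_dyadicAvg f k)
  rw [this]
  exact (measurable_of_countable _).comp (measurable_dyadicIndex k)

lemma integrableOn_Ioc_coe {f : UnitAddCircle → 𝕜} (hf : Integrable f volume) :
    IntegrableOn (fun t : ℝ => f (t : UnitAddCircle)) (Set.Ioc (0 : ℝ) 1) volume := by
  have := ((UnitAddCircle.measurePreserving_mk 0).integrable_comp hf.aestronglyMeasurable).2 hf
  rwa [zero_add] at this

/-- The martingale property: the average over a cell is the mean of the averages over its two
halves. -/
lemma dyadicAvg_eq_mean {f : UnitAddCircle → 𝕜} (hf : Integrable f volume) {k m : ℕ}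
    (hm : m < 2 ^ k) :
    dyadicAvg f (k + 1) (2 * m) + dyadicAvg f (k + 1) (2 * m + 1)
      = (2 : ℝ) • dyadicAvg f k m := by
  have h2 : (0 : ℝ) < 2 ^ k := by positivity
  have hm' : (m : ℝ) + 1 ≤ 2 ^ k := by exact_mod_cast hm
  have key : ∀ a b : ℝ, 0 ≤ a → a ≤ b → b ≤ 1 →
      IntervalIntegrable (fun t : ℝ => f (t : UnitAddCircle)) volume a b := by
    intro a b ha hab hb
    rw [intervalIntegrable_iff_integrableOn_Ioc_of_le hab]
    exact (integrableOn_Ioc_coe hf).mono_set (Set.Ioc_subset_Ioc ha hb)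
  have e1 : ((2 * m : ℕ) : ℝ) / 2 ^ (k + 1) = m / 2 ^ k := by
    push_cast; rw [pow_succ]; field_simp
  have e2 : (((2 * m + 1 : ℕ) : ℝ) + 1) / 2 ^ (k + 1) = (m + 1) / 2 ^ k := by
    push_cast; rw [pow_succ]; field_simp; ring
  have e3 : (((2 * m : ℕ) : ℝ) + 1) / 2 ^ (k + 1) = ((2 * m + 1 : ℕ) : ℝ) / 2 ^ (k + 1) := by
    push_cast; rfl
  have e4 : ((2 * m + 1 : ℕ) : ℝ) / 2 ^ (k + 1) = (m + 1 / 2) / 2 ^ k := by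
    push_cast; rw [pow_succ]; field_simp
  have hb : ((m : ℝ) + 1) / 2 ^ k ≤ 1 := (div_le_one h2).2 hm'
  have hle1 : (m : ℝ) / 2 ^ k ≤ (m + 1 / 2) / 2 ^ k := by gcongr; linarith
  have hle2 : ((m : ℝ) + 1 / 2) / 2 ^ k ≤ (m + 1) / 2 ^ k := by gcongr; norm_num
  simp only [dyadicAvg]
  rw [e1, e2, e3, e4, ← smul_add, intervalIntegral.integral_add_adjacent_intervals, smul_smul,
    pow_succ, mul_comm]
  · exact key _ _ (by positivity) hle1 (hle2.trans hb)
  · exact key _ _ (by positivity) hle2 hb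

/-- Lebesgue differentiation along balls that contain the point without being centred at it: up to
its right endpoint, a dyadic cell is the closed ball of radius `2^(-(k+1))` about its midpoint. -/
lemma ae_tendsto_dyadicE {f : UnitAddCircle → 𝕜} (hf : Integrable f volume) :
    ∀ᵐ x, Filter.Tendsto (fun k => dyadicE k f x) Filter.atTop (nhds (f x)) := by
  -- Extension by zero to the line, where the differentiation theorem is applied; all cells lie in
  -- `[0, 1]`, so averages do not change.
  set g : ℝ → 𝕜 := (Set.Ioc (0 : ℝ) 1).indicator fun t => f (t : UnitAddCircle)
  have hg : Integrable g := (integrable_indicator_iff measurableSet_Ioc).2 (integrableOn_Ioc_coe hf)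
  have hL := IsUnifLocDoublingMeasure.ae_tendsto_average (volume : Measure ℝ)
    hg.locallyIntegrable 1
  have hx : ∀ᵐ x, torusRep x ∈ Set.Ioc (0 : ℝ) 1 :=
    measurePreserving_torusRep.quasiMeasurePreserving.ae (ae_restrict_mem measurableSet_Ioc)
  have hT := measurePreserving_torusRep.quasiMeasurePreserving.ae (ae_restrict_of_ae hL)
  filter_upwards [hx, hT] with x hx1 hx2
  set δ : ℕ → ℝ := fun k => (2 ^ (k + 1))⁻¹
  set w : ℕ → ℝ := fun k => (dyadicIndex k x + 1 / 2) / 2 ^ k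
  have hδ : Filter.Tendsto δ Filter.atTop (nhdsWithin 0 (Set.Ioi 0)) := by
    refine tendsto_nhdsWithin_iff.2 ⟨?_, .of_forall fun k => by simp [δ]⟩
    have := (tendsto_pow_atTop_nhds_zero_of_lt_one (r := (1 / 2 : ℝ)) (by norm_num)
      (by norm_num)).comp (Filter.tendsto_add_atTop_nat 1)
    refine this.congr fun k => ?_
    simp [δ]
  have hball : ∀ k, Metric.closedBall (w k) (δ k)
      = Set.Icc ((dyadicIndex k x : ℝ) / 2 ^ k) ((dyadicIndex k x + 1) / 2 ^ k) := by
    intro k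
    rw [Real.closedBall_eq_Icc]
    congr 1 <;> simp only [w, δ] <;> rw [pow_succ] <;> field_simp <;> ring
  have hmem : ∀ k, torusRep x ∈ Metric.closedBall (w k) (1 * δ k) := by
    intro k
    have h2 : (0 : ℝ) < 2 ^ k := by positivity
    have h0 := torusRep_nonneg x
    rw [one_mul, hball, Set.mem_Icc, div_le_iff₀' h2, le_div_iff₀' h2]
    exact ⟨Nat.floor_le (by positivity), (Nat.lt_floor_add_one _).le⟩
  have h := hx2 w δ hδ (.of_forall hmem)
  have hgx : g (torusRep x) = f x := by
    simp only [g, Set.indicator_of_mem hx1, coe_torusRep]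
  rw [hgx] at h
  refine h.congr fun k => ?_
  have h2 : (0 : ℝ) < 2 ^ k := by positivity
  have hm : ((dyadicIndex k x : ℝ)) + 1 ≤ 2 ^ k := by exact_mod_cast dyadicIndex_lt k x
  have hle : (dyadicIndex k x : ℝ) / 2 ^ k ≤ (dyadicIndex k x + 1) / 2 ^ k := by gcongr; linarith
  rw [dyadicE_eq_dyadicAvg, dyadicAvg, hball, setAverage_eq, integral_Icc_eq_integral_Ioc,
    Real.volume_real_Icc_of_le hle, intervalIntegral.integral_of_le hle,
    show ((dyadicIndex k x : ℝ) + 1) / 2 ^ k - dyadicIndex k x / 2 ^ k = (2 ^ k)⁻¹ by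
      field_simp; ring, inv_inv]
  congr 1
  refine setIntegral_congr_fun measurableSet_Ioc fun t ht => ?_
  have ht' : t ∈ Set.Ioc (0 : ℝ) 1 :=
    ⟨lt_of_le_of_lt (by positivity) ht.1, ht.2.trans ((div_le_one h2).2 hm)⟩
  exact Set.indicator_of_mem ht' _

end DyadicAverages

section DyadicMartingales

/-! ### Sub-Gaussian bounds for dyadic martingales -/

lemma sum_range_two_mul_eq {M : Type*} [AddCommMonoid M] (G : ℕ → M) (n : ℕ) :
    ∑ m ∈ Finset.range (2 * n), G m = ∑ m ∈ Finset.range n, (G (2 * m) + G (2 * m + 1)) := by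
  induction n with
  | zero => simp
  | succ n ih =>
    rw [show 2 * (n + 1) = 2 * n + 1 + 1 by ring, Finset.sum_range_succ, Finset.sum_range_succ,
      Finset.sum_range_succ, ih, add_assoc]

/-- The two children of a cell deviate from it by `d` and `-d` with `|d| ≤ b`. One generation
therefore multiplies the mean of the exponential by at most `cosh d ≤ exp (b²/2)`. -/
lemma sum_exp_dyadic_martingale_le {c : ℕ → ℕ → ℝ} {b : ℕ → ℝ}
    (hc : ∀ k, ∀ m < 2 ^ k, c (k + 1) (2 * m) + c (k + 1) (2 * m + 1) = 2 * c k m)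
    (hb : ∀ k, ∀ m < 2 ^ (k + 1), |c (k + 1) m - c k (m / 2)| ≤ b k) (N j : ℕ) :
    ∑ m ∈ Finset.range (2 ^ (N + j)), Real.exp (c (N + j) m - c N (m / 2 ^ j))
      ≤ 2 ^ (N + j) * Real.exp ((∑ i ∈ Finset.range j, b (N + i) ^ 2) / 2) := by
  induction j with
  | zero => simp
  | succ j ih =>
    rw [← add_assoc, pow_succ', sum_range_two_mul_eq]
    have step : ∀ m ∈ Finset.range (2 ^ (N + j)),
        Real.exp (c (N + j + 1) (2 * m) - c N (2 * m / 2 ^ (j + 1)))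
          + Real.exp (c (N + j + 1) (2 * m + 1) - c N ((2 * m + 1) / 2 ^ (j + 1)))
        ≤ 2 * Real.exp (b (N + j) ^ 2 / 2) * Real.exp (c (N + j) m - c N (m / 2 ^ j)) := by
      intro m hm
      have hm := Finset.mem_range.1 hm
      have h1 := hc _ m hm
      have h2 := hb (N + j) (2 * m) (by rw [pow_succ]; omega)
      have e0 : 2 * m / 2 = m := by omega
      have e0' : (2 * m + 1) / 2 = m := by omega
      have e1 : 2 * m / 2 ^ (j + 1) = m / 2 ^ j := by
        rw [pow_succ', ← Nat.div_div_eq_div_mul, e0]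
      have e2 : (2 * m + 1) / 2 ^ (j + 1) = m / 2 ^ j := by
        rw [pow_succ', ← Nat.div_div_eq_div_mul, e0']
      rw [e0] at h2
      rw [e1, e2]
      set d := c (N + j + 1) (2 * m) - c (N + j) m with hd
      set s := c (N + j) m - c N (m / 2 ^ j) with hs
      have e3 : c (N + j + 1) (2 * m) - c N (m / 2 ^ j) = s + d := by rw [hd, hs]; ring
      have e4 : c (N + j + 1) (2 * m + 1) - c N (m / 2 ^ j) = s + -d := by
        rw [hd, hs]; linarith
      have h3 : Real.cosh d ≤ Real.exp (b (N + j) ^ 2 / 2) := by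
        refine (Real.cosh_le_exp_half_sq d).trans (Real.exp_le_exp.2 ?_)
        have := sq_le_sq.2 (h2.trans (le_abs_self _))
        linarith
      rw [e3, e4, Real.exp_add, Real.exp_add]
      rw [Real.cosh_eq] at h3
      nlinarith [Real.exp_pos s]
    refine (Finset.sum_le_sum step).trans ?_
    rw [← Finset.mul_sum, Finset.sum_range_succ, add_div, Real.exp_add]
    calc _ ≤ 2 * Real.exp (b (N + j) ^ 2 / 2)
          * (2 ^ (N + j) * Real.exp ((∑ i ∈ Finset.range j, b (N + i) ^ 2) / 2)) := by gcongr
      _ = _ := by ring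

variable {𝕜 : Type*} [RCLike 𝕜]

lemma exp_abs_le_exp_add_exp_neg (x : ℝ) : Real.exp |x| ≤ Real.exp x + Real.exp (-x) := by
  rcases abs_choice x with h | h <;> rw [h] <;> linarith [Real.exp_pos x, Real.exp_pos (-x)]

lemma norm_le_abs_re_add_abs_im (z : 𝕜) : ‖z‖ ≤ |RCLike.re z| + |RCLike.im z| := by
  refine le_of_sq_le_sq ?_ (by positivity)
  have h : ‖z‖ ^ 2 = RCLike.re z * RCLike.re z + RCLike.im z * RCLike.im z := RCLike.norm_sq_eq_def
  nlinarith [sq_abs (RCLike.re z), sq_abs (RCLike.im z),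
    mul_nonneg (abs_nonneg (RCLike.re z)) (abs_nonneg (RCLike.im z))]

/-- Reduction to the real case, applied to `±2t Re` and `±2t Im`. Since `uv ≤ (u² + v²)/2`, `exp
(t‖z‖)` is at most half the sum of the four exponentials, whence the factor `2`; the doubled
parameter produces `(2tb)²/2 = 2t²b²`. -/
lemma sum_exp_norm_dyadic_martingale_le {c : ℕ → ℕ → 𝕜} {b : ℕ → ℝ}
    (hc : ∀ k, ∀ m < 2 ^ k, c (k + 1) (2 * m) + c (k + 1) (2 * m + 1) = (2 : ℝ) • c k m)
    (hb : ∀ k, ∀ m < 2 ^ (k + 1), ‖c (k + 1) m - c k (m / 2)‖ ≤ b k) {t : ℝ} (ht : 0 ≤ t)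
    (N j : ℕ) :
    ∑ m ∈ Finset.range (2 ^ (N + j)), Real.exp (t * ‖c (N + j) m - c N (m / 2 ^ j)‖)
      ≤ 2 ^ (N + j) * (2 * Real.exp (2 * t ^ 2 * ∑ i ∈ Finset.range j, b (N + i) ^ 2)) := by
  have key : ∀ L : 𝕜 →ₗ[ℝ] ℝ, (∀ z, |L z| ≤ 2 * t * ‖z‖) →
      ∑ m ∈ Finset.range (2 ^ (N + j)), Real.exp (L (c (N + j) m - c N (m / 2 ^ j)))
      ≤ 2 ^ (N + j) * Real.exp (2 * t ^ 2 * ∑ i ∈ Finset.range j, b (N + i) ^ 2) := by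
    intro L hL
    have h := sum_exp_dyadic_martingale_le (c := fun k m => L (c k m)) (b := fun k => 2 * t * b k)
      (fun k m hm => by rw [← map_add, hc k m hm, map_smul, smul_eq_mul])
      (fun k m hm => by
        rw [← map_sub]
        exact (hL _).trans (mul_le_mul_of_nonneg_left (hb k m hm) (by positivity))) N j
    simp only [← map_sub] at h
    refine h.trans_eq ?_
    congr 2
    rw [Finset.mul_sum, Finset.sum_div]
    exact Finset.sum_congr rfl fun i _ => by ring
  set re : 𝕜 →ₗ[ℝ] ℝ := RCLike.reLm
  set im : 𝕜 →ₗ[ℝ] ℝ := RCLike.imLm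
  have hre : ∀ z : 𝕜, |re z| ≤ ‖z‖ := RCLike.abs_re_le_norm
  have him : ∀ z : 𝕜, |im z| ≤ ‖z‖ := RCLike.abs_im_le_norm
  have hsc : ∀ (L : 𝕜 →ₗ[ℝ] ℝ) (u : ℝ), |u| = 2 * t → (∀ z, |L z| ≤ ‖z‖) →
      ∀ z, |(u • L) z| ≤ 2 * t * ‖z‖ := by
    intro L u hu hL z
    rw [LinearMap.smul_apply, smul_eq_mul, abs_mul, hu]
    exact mul_le_mul_of_nonneg_left (hL z) (by positivity)
  have habs : |2 * t| = 2 * t := abs_of_nonneg (by positivity)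
  have habs' : |-(2 * t)| = 2 * t := by rw [abs_neg, habs]
  have h1 := key ((2 * t) • re) (hsc re _ habs hre)
  have h2 := key ((-(2 * t)) • re) (hsc re _ habs' hre)
  have h3 := key ((2 * t) • im) (hsc im _ habs him)
  have h4 := key ((-(2 * t)) • im) (hsc im _ habs' him)
  have hpt : ∀ z : 𝕜, Real.exp (t * ‖z‖) ≤ (1 / 2) * (Real.exp (((2 * t) • re) z)
      + Real.exp (((-(2 * t)) • re) z) + Real.exp (((2 * t) • im) z)
      + Real.exp (((-(2 * t)) • im) z)) := by
    intro z
    simp only [LinearMap.smul_apply, smul_eq_mul, neg_mul]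
    have hz : ‖z‖ ≤ |re z| + |im z| := norm_le_abs_re_add_abs_im z
    have hr := exp_abs_le_exp_add_exp_neg (2 * t * re z)
    have hi := exp_abs_le_exp_add_exp_neg (2 * t * im z)
    rw [abs_mul, habs] at hr hi
    have hz' : Real.exp (t * ‖z‖) ≤ Real.exp (t * |re z|) * Real.exp (t * |im z|) := by
      rw [← Real.exp_add, ← mul_add]
      gcongr
    have e1 : Real.exp (2 * t * |re z|) = Real.exp (t * |re z|) ^ 2 := by
      rw [← Real.exp_nat_mul]; push_cast; ring_nf
    have e2 : Real.exp (2 * t * |im z|) = Real.exp (t * |im z|) ^ 2 := by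
      rw [← Real.exp_nat_mul]; push_cast; ring_nf
    nlinarith [sq_nonneg (Real.exp (t * |re z|) - Real.exp (t * |im z|))]
  refine (Finset.sum_le_sum fun m _ => hpt _).trans ?_
  rw [← Finset.mul_sum, Finset.sum_add_distrib, Finset.sum_add_distrib, Finset.sum_add_distrib]
  linarith

/-- This is `u ≤ exp u` at `u = yx/p`, raised to the power `p`. It serves both to pass from
exponential moments to `p`-th moments and to compare `2^(-N)` with a power of `N+1`. -/
lemma rpow_le_rpow_mul_exp {x y p : ℝ} (hx : 0 ≤ x) (hy : 0 < y) (hp : 0 < p) :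
    x ^ p ≤ (p / y) ^ p * Real.exp (y * x) := by
  have h1 : y * x / p ≤ Real.exp (y * x / p) := by linarith [Real.add_one_le_exp (y * x / p)]
  have h2 := Real.rpow_le_rpow (by positivity) h1 hp.le
  rw [← Real.exp_mul, div_mul_cancel₀ _ hp.ne'] at h2
  have e : x = (p / y) * (y * x / p) := by field_simp
  calc x ^ p = (p / y) ^ p * (y * x / p) ^ p := by
        rw [← Real.mul_rpow (by positivity) (by positivity), ← e]
    _ ≤ _ := by gcongr

lemma sum_rpow_norm_dyadic_martingale_le {c : ℕ → ℕ → 𝕜} {b : ℕ → ℝ}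
    (hc : ∀ k, ∀ m < 2 ^ k, c (k + 1) (2 * m) + c (k + 1) (2 * m + 1) = (2 : ℝ) • c k m)
    (hb : ∀ k, ∀ m < 2 ^ (k + 1), ‖c (k + 1) m - c k (m / 2)‖ ≤ b k) {N j : ℕ} {σ p : ℝ}
    (hσ : 0 < σ) (hbσ : ∑ i ∈ Finset.range j, b (N + i) ^ 2 ≤ σ ^ 2) (hp : 1 ≤ p) :
    ∑ m ∈ Finset.range (2 ^ (N + j)), ‖c (N + j) m - c N (m / 2 ^ j)‖ ^ p
      ≤ 2 ^ (N + j) * (2 * Real.exp 2 * √p * σ) ^ p := by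
  have hp0 : 0 < p := by linarith
  have hsp : 0 < √p := Real.sqrt_pos.2 hp0
  have hsq : √p ^ 2 = p := Real.sq_sqrt hp0.le
  -- With this `t` the prefactor is `p/t = √p σ` and the exponent is at most `2t²σ² = 2p`, so the
  -- exponential is absorbed into a `p`-th power.
  set t := √p / σ
  have ht : 0 < t := by positivity
  have hpt : p / t = √p * σ := by
    rw [div_div_eq_mul_div, div_eq_iff hsp.ne']
    nlinarith
  have hexp : 2 * t ^ 2 * ∑ i ∈ Finset.range j, b (N + i) ^ 2 ≤ 2 * p := by
    calc _ ≤ 2 * t ^ 2 * σ ^ 2 := by gcongr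
      _ = 2 * p := by rw [div_pow, hsq]; field_simp
  calc _ ≤ ∑ m ∈ Finset.range (2 ^ (N + j)),
        (p / t) ^ p * Real.exp (t * ‖c (N + j) m - c N (m / 2 ^ j)‖) :=
        Finset.sum_le_sum fun m _ => rpow_le_rpow_mul_exp (norm_nonneg _) ht hp0
    _ ≤ (p / t) ^ p * (2 ^ (N + j) * (2 * Real.exp (2 * p))) := by
        rw [← Finset.mul_sum]
        refine mul_le_mul_of_nonneg_left ?_ (by positivity)
        refine (sum_exp_norm_dyadic_martingale_le hc hb ht.le N j).trans ?_
        gcongr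
    _ ≤ (p / t) ^ p * (2 ^ (N + j) * (2 ^ p * Real.exp (2 * p))) := by
        gcongr
        exact Real.self_le_rpow_of_one_le (by norm_num) hp
    _ = _ := by
        rw [hpt, Real.exp_mul, show 2 * Real.exp 2 * √p * σ = (√p * σ) * (2 * Real.exp 2) by ring,
          Real.mul_rpow (x := √p * σ) (by positivity) (by positivity),
          Real.mul_rpow (x := 2) (by positivity) (by positivity)]
        ring

end DyadicMartingales

section PowerSums

/-! ### Sums of powers -/

/-- Bernoulli's inequality for exponents in `[0, 1]`; it is the telescoping step in the bound for
partial sums of `(i+1)^(-s)` with `s < 1`. -/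
lemma rpow_sub_one_le {y r : ℝ} (hy : 1 ≤ y) (hr0 : 0 ≤ r) (hr1 : r ≤ 1) :
    (y - 1) ^ r ≤ y ^ r - r * y ^ (r - 1) := by
  have hy0 : 0 < y := by linarith
  have h := rpow_one_add_le_one_add_mul_self (s := -y⁻¹)
    (by rw [neg_le_neg_iff]; exact inv_le_one_of_one_le₀ hy) hr0 hr1
  have hnn : 0 ≤ 1 + -y⁻¹ := by linarith [inv_le_one_of_one_le₀ hy]
  calc (y - 1) ^ r = y ^ r * (1 + -y⁻¹) ^ r := by
        rw [← Real.mul_rpow hy0.le hnn]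
        congr 1
        field_simp
        ring
    _ ≤ y ^ r * (1 + r * -y⁻¹) := by gcongr
    _ = _ := by rw [Real.rpow_sub_one hy0.ne']; ring

lemma sum_rpow_neg_le {s : ℝ} (hs0 : 0 ≤ s) (hs1 : s < 1) (n : ℕ) :
    ∑ i ∈ Finset.range n, ((i : ℝ) + 1) ^ (-s) ≤ (1 - s)⁻¹ * (n : ℝ) ^ (1 - s) := by
  induction n with
  | zero => simp [Real.zero_rpow (by linarith : 1 - s ≠ 0)]
  | succ n ih =>
    have h := rpow_sub_one_le (y := (n : ℝ) + 1) (r := 1 - s) (by simp) (by linarith) (by linarith)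
    rw [add_sub_cancel_right, show 1 - s - 1 = -s by ring] at h
    rw [Finset.sum_range_succ]
    push_cast
    have h1 : 0 < 1 - s := by linarith
    calc _ ≤ (1 - s)⁻¹ * (n : ℝ) ^ (1 - s) + ((n : ℝ) + 1) ^ (-s) := by gcongr
      _ = (1 - s)⁻¹ * ((n : ℝ) ^ (1 - s) + (1 - s) * ((n : ℝ) + 1) ^ (-s)) := by field_simp
      _ ≤ _ := by gcongr; linarith

lemma rpow_neg_sub_one_ge {y r : ℝ} (hy : 1 < y) (hr : 0 ≤ r) :
    y ^ (-r) + r * y ^ (-r - 1) ≤ (y - 1) ^ (-r) := by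
  have hy0 : 0 < y := by linarith
  have hlt : y⁻¹ < 1 := inv_lt_one_of_one_lt₀ hy
  have hpos : 0 < 1 + -y⁻¹ := by linarith
  have h : 1 + r * y⁻¹ ≤ (1 + -y⁻¹) ^ (-r) := by
    rw [Real.rpow_def_of_pos hpos]
    have h1 := Real.log_le_sub_one_of_pos hpos
    have h2 := Real.add_one_le_exp (Real.log (1 + -y⁻¹) * -r)
    nlinarith
  calc y ^ (-r) + r * y ^ (-r - 1) = y ^ (-r) * (1 + r * y⁻¹) := by
        rw [Real.rpow_sub_one hy0.ne']; ring
    _ ≤ y ^ (-r) * (1 + -y⁻¹) ^ (-r) := by gcongr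
    _ = _ := by
        rw [← Real.mul_rpow hy0.le hpos.le]
        congr 1
        field_simp
        ring

/-- Comparison with the integral of `x^(-s)`, proved by telescoping. The subtracted term is kept so
that the induction closes. -/
lemma sum_rpow_neg_tail_le {s : ℝ} (hs : 1 < s) (N n : ℕ) :
    ∑ i ∈ Finset.range n, ((N : ℝ) + i + 2) ^ (-s)
      ≤ (s - 1)⁻¹ * (((N : ℝ) + 1) ^ (1 - s) - ((N : ℝ) + n + 1) ^ (1 - s)) := by
  induction n with
  | zero => simp
  | succ n ih =>
    have h := rpow_neg_sub_one_ge (y := (N : ℝ) + n + 2) (r := s - 1)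
      (by linarith [(Nat.cast_nonneg N : (0 : ℝ) ≤ N), (Nat.cast_nonneg n : (0 : ℝ) ≤ n)])
      (by linarith)
    rw [show -(s - 1) - 1 = -s by ring, show -(s - 1) = 1 - s by ring,
      show (N : ℝ) + n + 2 - 1 = N + n + 1 by ring] at h
    rw [Finset.sum_range_succ]
    push_cast
    rw [show (N : ℝ) + (n + 1) + 1 = N + n + 2 by ring]
    have h1 : 0 < s - 1 := by linarith
    calc _ ≤ (s - 1)⁻¹ * (((N : ℝ) + 1) ^ (1 - s) - ((N : ℝ) + n + 1) ^ (1 - s))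
          + ((N : ℝ) + n + 2) ^ (-s) := by gcongr
      _ = (s - 1)⁻¹ * (((N : ℝ) + 1) ^ (1 - s) - ((N : ℝ) + n + 1) ^ (1 - s)
          + (s - 1) * ((N : ℝ) + n + 2) ^ (-s)) := by field_simp
      _ ≤ _ := by gcongr; linarith

end PowerSums

section DyadicTails

/-! ### Tails of the dyadic martingale of a function -/

variable {𝕜 : Type*} [RCLike 𝕜]

lemma norm_dyadicD_le_of_eLGdyadNorm_le {γ A : ℝ} {f : UnitAddCircle → 𝕜}
    (hf : eLGdyadNorm γ f ≤ ENNReal.ofReal A) (hA : 0 ≤ A) (k : ℕ) :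
    ∀ᵐ x, ‖dyadicD k f x‖ ≤ A * ((k : ℝ) + 1) ^ (-γ) := by
  have hk : (0 : ℝ) < (k : ℝ) + 1 := by positivity
  have h1 : ENNReal.ofReal (((k : ℝ) + 1) ^ γ) * eLpNorm (dyadicD k f) ∞ volume
      ≤ ENNReal.ofReal A := (le_iSup (fun k : ℕ =>
        ENNReal.ofReal (((k : ℝ) + 1) ^ γ) * eLpNorm (dyadicD k f) ∞ volume) k).trans hf
  filter_upwards [ae_le_eLpNormEssSup (f := dyadicD k f) (μ := volume)] with x hx
  rw [eLpNorm_exponent_top] at h1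
  have h2 : ENNReal.ofReal (((k : ℝ) + 1) ^ γ * ‖dyadicD k f x‖) ≤ ENNReal.ofReal A := by
    rw [ENNReal.ofReal_mul (by positivity), ofReal_norm]
    exact (mul_le_mul_right hx _).trans h1
  rw [ENNReal.ofReal_le_ofReal_iff hA] at h2
  rw [Real.rpow_neg hk.le, ← div_eq_mul_inv, le_div_iff₀ (by positivity)]
  linarith

lemma norm_dyadicAvg_zero_le {γ A : ℝ} {f : UnitAddCircle → 𝕜}
    (hf : eLGdyadNorm γ f ≤ ENNReal.ofReal A) (hA : 0 ≤ A) : ‖dyadicAvg f 0 0‖ ≤ A := by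
  have h := norm_dyadicD_le_of_eLGdyadNorm_le hf hA 0
  simp only [dyadicD, dyadicE_eq_dyadicAvg] at h
  simpa using of_ae_comp_dyadicIndex (P := fun m => ‖dyadicAvg f 0 m‖ ≤ A * _) h (m := 0) (by simp)

lemma norm_dyadicAvg_sub_le {γ A : ℝ} {f : UnitAddCircle → 𝕜}
    (hf : eLGdyadNorm γ f ≤ ENNReal.ofReal A) (hA : 0 ≤ A) (k : ℕ) {m : ℕ}
    (hm : m < 2 ^ (k + 1)) :
    ‖dyadicAvg f (k + 1) m - dyadicAvg f k (m / 2)‖ ≤ A * ((k : ℝ) + 2) ^ (-γ) := by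
  have h := norm_dyadicD_le_of_eLGdyadNorm_le hf hA (k + 1)
  have hi : ∀ x, dyadicIndex k x = dyadicIndex (k + 1) x / 2 := fun x => by
    simpa using (dyadicIndex_div k 1 x).symm
  simp only [dyadicD, dyadicE_eq_dyadicAvg, hi] at h
  have := of_ae_comp_dyadicIndex
    (P := fun m => ‖dyadicAvg f (k + 1) m - dyadicAvg f k (m / 2)‖ ≤ A * _) h hm
  convert this using 3
  push_cast
  ring

lemma norm_dyadicE_sub_le {γ A : ℝ} {f : UnitAddCircle → 𝕜}
    (hf : eLGdyadNorm γ f ≤ ENNReal.ofReal A) (hA : 0 ≤ A) (N j : ℕ) (x : UnitAddCircle) :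
    ‖dyadicE (N + j) f x - dyadicE N f x‖
      ≤ A * ∑ i ∈ Finset.range j, ((N : ℝ) + i + 2) ^ (-γ) := by
  induction j with
  | zero => simp
  | succ j ih =>
    have h := norm_dyadicAvg_sub_le hf hA (N + j) (dyadicIndex_lt (N + j + 1) x)
    have hi : dyadicIndex (N + j + 1) x / 2 = dyadicIndex (N + j) x := by
      simpa using dyadicIndex_div (N + j) 1 x
    rw [hi, ← dyadicE_eq_dyadicAvg, ← dyadicE_eq_dyadicAvg] at h
    push_cast at h
    rw [Finset.sum_range_succ, mul_add]
    calc _ ≤ ‖dyadicE (N + j) f x - dyadicE N f x‖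
          + ‖dyadicE (N + j + 1) f x - dyadicE (N + j) f x‖ := by
          rw [← add_assoc, add_comm ‖_‖, ← sub_add_sub_cancel _ (dyadicE (N + j) f x)]
          exact norm_add_le _ _
      _ ≤ _ := add_le_add ih h

/-- The increments after generation `N` are at most `A (k+2)^(-γ)`, and their squares are summable
because `γ > 1/2`. The bound does not depend on `j`, as the passage to the limit requires. -/
lemma eLpNorm_dyadicE_sub_le {γ A : ℝ} {f : UnitAddCircle → 𝕜} (hfi : Integrable f volume)
    (hf : eLGdyadNorm γ f ≤ ENNReal.ofReal A) (hA : 0 < A) (hγ : 1 / 2 < γ) {p : ℝ} (hp : 1 ≤ p)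
    (N j : ℕ) :
    eLpNorm (fun x => dyadicE (N + j) f x - dyadicE N f x) (ENNReal.ofReal p) volume
      ≤ ENNReal.ofReal (A * (2 * Real.exp 2 * (√(2 * γ - 1))⁻¹ * √p
          * ((N : ℝ) + 1) ^ (1 / 2 - γ))) := by
  have hp0 : 0 < p := by linarith
  have hN : (0 : ℝ) < (N : ℝ) + 1 := by positivity
  have hγ' : 0 < 2 * γ - 1 := by linarith
  -- `σ²` is `A²` times the integral bound for the tail of `∑ k^(-2γ)`.
  set σ := A * (√(2 * γ - 1))⁻¹ * ((N : ℝ) + 1) ^ (1 / 2 - γ)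
  have hσ : 0 < σ := by positivity
  set b : ℕ → ℝ := fun k => A * ((k : ℝ) + 2) ^ (-γ)
  have hbσ : ∑ i ∈ Finset.range j, b (N + i) ^ 2 ≤ σ ^ 2 := by
    have h := sum_rpow_neg_tail_le (s := 2 * γ) (by linarith) N j
    have h0 : 0 ≤ ((N : ℝ) + j + 1) ^ (1 - 2 * γ) := by positivity
    have e1 : σ ^ 2 = A ^ 2 * ((2 * γ - 1)⁻¹ * ((N : ℝ) + 1) ^ (1 - 2 * γ)) := by
      simp only [σ]
      rw [mul_pow, mul_pow, inv_pow, Real.sq_sqrt hγ'.le, ← Real.rpow_mul_natCast hN.le,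
        mul_assoc]
      congr 3
      push_cast
      ring
    have e2 : ∀ i ∈ Finset.range j, b (N + i) ^ 2 = A ^ 2 * ((N : ℝ) + i + 2) ^ (-(2 * γ)) := by
      intro i _
      simp only [b]
      rw [mul_pow, ← Real.rpow_mul_natCast (by positivity)]
      congr 2
      · push_cast; ring
      · push_cast; ring
    rw [e1, Finset.sum_congr rfl e2, ← Finset.mul_sum]
    gcongr
    refine h.trans ?_
    gcongr
    linarith
  have hsum := sum_rpow_norm_dyadic_martingale_le (c := dyadicAvg f)
    (fun k m hm => dyadicAvg_eq_mean hfi hm)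
    (fun k m hm => norm_dyadicAvg_sub_le hf hA.le k hm) hσ hbσ hp
  set R := 2 * Real.exp 2 * √p * σ
  have hR : A * (2 * Real.exp 2 * (√(2 * γ - 1))⁻¹ * √p * ((N : ℝ) + 1) ^ (1 / 2 - γ)) = R := by
    simp only [R, σ]; ring
  rw [hR, eLpNorm_eq_lintegral_rpow_enorm_toReal (by simpa using hp0) ENNReal.ofReal_ne_top,
    ENNReal.toReal_ofReal hp0.le, one_div, ENNReal.rpow_inv_le_iff hp0]
  obtain ⟨G, hGm⟩ : ∃ G : ℕ → ℝ≥0∞, ∀ m, G m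
      = ENNReal.ofReal (‖dyadicAvg f (N + j) m - dyadicAvg f N (m / 2 ^ j)‖ ^ p) :=
    ⟨_, fun _ => rfl⟩
  have hG : ∀ x, ‖dyadicE (N + j) f x - dyadicE N f x‖ₑ ^ p = G (dyadicIndex (N + j) x) := by
    intro x
    rw [hGm, dyadicIndex_div, ← dyadicE_eq_dyadicAvg, ← dyadicE_eq_dyadicAvg,
      ← ENNReal.ofReal_rpow_of_nonneg (norm_nonneg _) hp0.le, ofReal_norm]
  rw [(lintegral_congr hG).trans (lintegral_comp_dyadicIndex _ _),
    Finset.sum_congr rfl fun m _ => hGm m, ← ENNReal.ofReal_sum_of_nonneg (fun _ _ => by positivity),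
    mul_comm, ← div_eq_mul_inv]
  refine ENNReal.div_le_of_le_mul ?_
  rw [ENNReal.ofReal_rpow_of_nonneg (by positivity) hp0.le]
  have e3 : ((2 : ℝ≥0∞) ^ (N + j)) = ENNReal.ofReal (2 ^ (N + j)) := by
    rw [ENNReal.ofReal_pow (by norm_num)]; simp
  rw [e3, ← ENNReal.ofReal_mul (by positivity), mul_comm (R ^ p)]
  exact ENNReal.ofReal_le_ofReal hsum

/-- Fatou's lemma along the almost everywhere convergence `𝔼_{N+j} f → f`. -/
lemma eLpNorm_sub_dyadicE_le_of_forall {f : UnitAddCircle → 𝕜} (hf : Integrable f volume) {N : ℕ}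
    {p B : ℝ≥0∞}
    (h : ∀ j, eLpNorm (fun x => dyadicE (N + j) f x - dyadicE N f x) p volume ≤ B) :
    eLpNorm (fun x => f x - dyadicE N f x) p volume ≤ B := by
  refine (Lp.eLpNorm_lim_le_liminf_eLpNorm
    (f := fun j x => dyadicE (N + j) f x - dyadicE N f x)
    (fun j => ((measurable_dyadicE f _).sub (measurable_dyadicE f _)).aestronglyMeasurable)
    _ ?_).trans ?_
  · filter_upwards [ae_tendsto_dyadicE hf] with x hx
    refine Filter.Tendsto.sub_const ?_ _
    simpa only [Function.comp_def, add_comm] using hx.comp (Filter.tendsto_add_atTop_nat N)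
  · refine (Filter.liminf_le_liminf (.of_forall h)).trans_eq ?_
    exact Filter.liminf_const B

lemma eLpNorm_sub_dyadicE_le {γ A : ℝ} {f : UnitAddCircle → 𝕜} (hfi : Integrable f volume)
    (hf : eLGdyadNorm γ f ≤ ENNReal.ofReal A) (hA : 0 < A) (hγ : 1 / 2 < γ) {p : ℝ} (hp : 1 ≤ p)
    (N : ℕ) :
    eLpNorm (fun x => f x - dyadicE N f x) (ENNReal.ofReal p) volume
      ≤ ENNReal.ofReal (A * (2 * Real.exp 2 * (√(2 * γ - 1))⁻¹ * √p
          * ((N : ℝ) + 1) ^ (1 / 2 - γ))) :=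
  eLpNorm_sub_dyadicE_le_of_forall hfi fun j => eLpNorm_dyadicE_sub_le hfi hf hA hγ hp N j

/-! ### The `exp L^ν` norm of the tail -/

lemma eLpNorm_le_of_bound_of_probability {f : UnitAddCircle → 𝕜} {B : ℝ} {p : ℝ≥0∞}
    (h : ∀ x, ‖f x‖ ≤ B) : eLpNorm f p volume ≤ ENNReal.ofReal B := by
  refine (eLpNorm_le_of_ae_bound (.of_forall h)).trans_eq ?_
  simp

/-- The Gaussian part of the tail estimate, for `p` at most the generation `M`. -/
lemma rpow_mul_sqrt_mul_rpow_le {γ ν p : ℝ} (hν : 2 ≤ ν) (hγ : 1 - 1 / ν < γ) (hp : 1 ≤ p)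
    {N M : ℕ} (hNM : N ≤ M) (hpM : p ≤ (M : ℝ) + 1) :
    p ^ (-1 / ν) * √p * ((M : ℝ) + 1) ^ (1 / 2 - γ) ≤ ((N : ℝ) + 1) ^ (1 - γ - 1 / ν) := by
  have hp0 : 0 < p := by linarith
  have hM : (0 : ℝ) < (M : ℝ) + 1 := by positivity
  have hν' : 1 / ν ≤ 1 / 2 := one_div_le_one_div_of_le (by norm_num) hν
  calc _ = p ^ (1 / 2 - 1 / ν) * ((M : ℝ) + 1) ^ (1 / 2 - γ) := by
        rw [Real.sqrt_eq_rpow, ← Real.rpow_add hp0]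
        congr 2
        ring
    -- Here `ν ≥ 2` enters: the exponent of `p` is nonnegative, so `p` may be replaced by `M+1`.
    _ ≤ ((M : ℝ) + 1) ^ (1 / 2 - 1 / ν) * ((M : ℝ) + 1) ^ (1 / 2 - γ) := by
        gcongr
    _ = ((M : ℝ) + 1) ^ (1 - γ - 1 / ν) := by
        rw [← Real.rpow_add hM]
        congr 1
        ring
    _ ≤ _ := Real.rpow_le_rpow_of_nonpos (by positivity) (by gcongr) (by linarith)

/-- The uniform part of the tail estimate, for `p` at least the generation. -/
lemma exists_rpow_mul_sum_rpow_le {γ ν : ℝ} (hν : 2 ≤ ν) (hγ : 1 - 1 / ν < γ) :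
    ∃ K : ℝ, 0 < K ∧ ∀ (p : ℝ) (N j : ℕ), (N : ℝ) + 1 ≤ p → (j : ℝ) ≤ p →
      p ^ (-1 / ν) * ∑ i ∈ Finset.range j, ((N : ℝ) + i + 2) ^ (-γ)
        ≤ K * ((N : ℝ) + 1) ^ (1 - γ - 1 / ν) := by
  have hν0 : 0 < 1 / ν := by positivity
  have hν' : 1 / ν ≤ 1 / 2 := one_div_le_one_div_of_le (by norm_num) hν
  -- With `s = 1 - 1/ν + β`, the bound `β < 1/ν` gives `s < 1`, so the first `j ≤ p` terms of `∑
  -- (i+1)^(-s)` add up to `O(p^(1/ν-β))`. The other bound gives `s ≤ γ`, so a factor `(N+1)^(s-γ)`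
  -- can be extracted. The remaining `p^(-β)` is at most `(N+1)^(-β)`, and no distinction between `γ
  -- < 1`, `γ = 1` and `γ > 1` arises.
  obtain ⟨β, hβ0, hβa, hβν⟩ : ∃ β : ℝ, 0 < β ∧ β ≤ γ - 1 + 1 / ν ∧ β < 1 / ν :=
    ⟨min (γ - 1 + 1 / ν) (1 / ν / 2), lt_min (by linarith) (by linarith), min_le_left _ _,
      (min_le_right _ _).trans_lt (by linarith)⟩
  set s := 1 - 1 / ν + β with hs
  have hs1 : s < 1 := by linarith
  have hs0 : 0 ≤ s := by linarith
  have h1s : 0 < 1 - s := by linarith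
  refine ⟨(1 - s)⁻¹, by positivity, fun p N j hNp hjp => ?_⟩
  have hN : (0 : ℝ) < (N : ℝ) + 1 := by positivity
  have hp0 : 0 < p := by linarith
  have hterm : ∀ i ∈ Finset.range j,
      ((N : ℝ) + i + 2) ^ (-γ) ≤ ((N : ℝ) + 1) ^ (s - γ) * ((i : ℝ) + 1) ^ (-s) := by
    intro i _
    have hi : (0 : ℝ) < (N : ℝ) + i + 2 := by positivity
    calc ((N : ℝ) + i + 2) ^ (-γ) = ((N : ℝ) + i + 2) ^ (s - γ) * ((N : ℝ) + i + 2) ^ (-s) := by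
          rw [← Real.rpow_add hi]; congr 1; ring
      _ ≤ _ := by
          gcongr ?_ * ?_
          · refine Real.rpow_le_rpow_of_nonpos hN ?_ (by linarith)
            linarith [(Nat.cast_nonneg i : (0 : ℝ) ≤ i)]
          · refine Real.rpow_le_rpow_of_nonpos (by positivity) ?_ (by linarith)
            linarith
  calc _ ≤ p ^ (-1 / ν) * (((N : ℝ) + 1) ^ (s - γ) * ((1 - s)⁻¹ * p ^ (1 - s))) := by
        gcongr
        refine (Finset.sum_le_sum hterm).trans ?_
        rw [← Finset.mul_sum]
        gcongr
        refine (sum_rpow_neg_le hs0 hs1 j).trans ?_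
        gcongr
    _ = (1 - s)⁻¹ * (((N : ℝ) + 1) ^ (s - γ) * p ^ (-β)) := by
        have : p ^ (-β) = p ^ (-1 / ν) * p ^ (1 - s) := by
          rw [← Real.rpow_add hp0]; congr 1; rw [hs]; ring
        rw [this]; ring
    _ ≤ (1 - s)⁻¹ * (((N : ℝ) + 1) ^ (s - γ) * ((N : ℝ) + 1) ^ (-β)) := by
        gcongr ?_ * (?_ * ?_)
        exact Real.rpow_le_rpow_of_nonpos hN hNp (by linarith)
    _ = _ := by
        rw [← Real.rpow_add hN]
        congr 2
        rw [hs]; ring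

lemma exists_eExpLNorm_sub_dyadicE_le_of_two_le {γ ν : ℝ} (hν : 2 ≤ ν) (hγ : 1 - 1 / ν < γ) :
    ∃ K : ℝ, 0 < K ∧ ∀ (f : UnitAddCircle → 𝕜), Integrable f volume → ∀ A : ℝ, 0 < A →
      eLGdyadNorm γ f ≤ ENNReal.ofReal A → ∀ N : ℕ,
        eExpLNorm ν (fun x => f x - dyadicE N f x)
          ≤ ENNReal.ofReal (A * K * ((N : ℝ) + 1) ^ (1 - γ - 1 / ν)) := by
  have hν' : 1 / ν ≤ 1 / 2 := one_div_le_one_div_of_le (by norm_num) hν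
  have hγ2 : 1 / 2 < γ := by linarith
  have hγ' : 0 < 2 * γ - 1 := by linarith
  obtain ⟨K₂, hK₂, hsup⟩ := exists_rpow_mul_sum_rpow_le hν hγ
  set K₁ := 2 * Real.exp 2 * (√(2 * γ - 1))⁻¹
  have hK₁ : 0 < K₁ := by positivity
  refine ⟨K₁ + K₂, by positivity, fun f hfi A hA hf N => iSup₂_le fun p hp => ?_⟩
  have hp0 : 0 < p := by linarith
  have hN : (0 : ℝ) < (N : ℝ) + 1 := by positivity
  set T := ((N : ℝ) + 1) ^ (1 - γ - 1 / ν)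
  have hT : 0 < T := by positivity
  have hgauss : ∀ M : ℕ, N ≤ M → p ≤ (M : ℝ) + 1 → ENNReal.ofReal (p ^ (-1 / ν))
      * eLpNorm (fun x => f x - dyadicE M f x) (ENNReal.ofReal p) volume
      ≤ ENNReal.ofReal (A * K₁ * T) := by
    intro M hNM hpM
    refine (mul_le_mul_right (eLpNorm_sub_dyadicE_le hfi hf hA hγ2 hp M) _).trans ?_
    rw [← ENNReal.ofReal_mul (by positivity)]
    refine ENNReal.ofReal_le_ofReal ?_
    calc _ = A * K₁ * (p ^ (-1 / ν) * √p * ((M : ℝ) + 1) ^ (1 / 2 - γ)) := by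
          simp only [K₁]; ring
      _ ≤ _ := by gcongr; exact rpow_mul_sqrt_mul_rpow_le hν hγ hp hNM hpM
  rcases lt_or_ge p ((N : ℝ) + 1) with hpN | hpN
  · refine (hgauss N le_rfl hpN.le).trans (ENNReal.ofReal_le_ofReal ?_)
    gcongr
    linarith
  -- The intermediate generation is `⌊p⌋ = N + j`: late enough for the Gaussian bound at `p`, and
  -- early enough that only `j ≤ p` increments are summed in sup norm.
  · obtain ⟨j, hj⟩ : ∃ j, ⌊p⌋₊ = N + j := Nat.exists_eq_add_of_le (by
      rw [Nat.le_floor_iff hp0.le]; linarith)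
    have hfl := Nat.floor_le hp0.le
    have hfl' := (Nat.lt_floor_add_one p).le
    rw [hj] at hfl hfl'
    have h1 := hgauss (N + j) (by omega) hfl'
    push_cast at hfl
    have h2 : ENNReal.ofReal (p ^ (-1 / ν))
        * eLpNorm (fun x => dyadicE (N + j) f x - dyadicE N f x) (ENNReal.ofReal p) volume
        ≤ ENNReal.ofReal (A * K₂ * T) := by
      refine (mul_le_mul_right (eLpNorm_le_of_bound_of_probability
        (norm_dyadicE_sub_le hf hA.le N j)) _).trans ?_
      rw [← ENNReal.ofReal_mul (by positivity)]
      refine ENNReal.ofReal_le_ofReal ?_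
      have := hsup p N j hpN (by linarith [(Nat.cast_nonneg N : (0 : ℝ) ≤ N)])
      calc _ = A * (p ^ (-1 / ν) * ∑ i ∈ Finset.range j, ((N : ℝ) + i + 2) ^ (-γ)) := by ring
        _ ≤ A * (K₂ * T) := by gcongr
        _ = _ := by ring
    have e : (fun x => f x - dyadicE N f x) = (fun x => f x - dyadicE (N + j) f x)
        + fun x => dyadicE (N + j) f x - dyadicE N f x := by
      funext x; simp
    rw [e]
    refine (mul_le_mul_right (eLpNorm_add_le ?_ ?_ (by simpa using hp)) _).trans ?_
    · exact hfi.aestronglyMeasurable.sub (measurable_dyadicE f _).aestronglyMeasurable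
    · exact ((measurable_dyadicE f _).sub (measurable_dyadicE f _)).aestronglyMeasurable
    rw [mul_add]
    refine (add_le_add h1 h2).trans ?_
    rw [← ENNReal.ofReal_add (by positivity) (by positivity)]
    exact ENNReal.ofReal_le_ofReal (by rw [mul_add, add_mul])

lemma eExpLNorm_mono {ν μ : ℝ} (hν : 0 < ν) (h : ν ≤ μ) (f : UnitAddCircle → 𝕜) :
    eExpLNorm ν f ≤ eExpLNorm μ f := by
  refine iSup₂_mono fun p hp => ?_
  gcongr ENNReal.ofReal ?_ * _
  refine Real.rpow_le_rpow_of_exponent_le hp ?_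
  rw [neg_div, neg_div, neg_le_neg_iff]
  exact one_div_le_one_div_of_le hν h

/-- For `ν < 2` the stronger `exp L²` norm is estimated instead; `max ν 2` unites the two regimes.
-/
lemma exists_eExpLNorm_sub_dyadicE_le {γ ν : ℝ} (hν : 0 < ν) (hγ : 1 - 1 / max ν 2 < γ) :
    ∃ K : ℝ, 0 < K ∧ ∀ (f : UnitAddCircle → 𝕜), Integrable f volume → ∀ A : ℝ, 0 < A →
      eLGdyadNorm γ f ≤ ENNReal.ofReal A → ∀ N : ℕ,
        eExpLNorm ν (fun x => f x - dyadicE N f x)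
          ≤ ENNReal.ofReal (A * K * ((N : ℝ) + 1) ^ (1 - γ - 1 / max ν 2)) := by
  obtain ⟨K, hK, h⟩ := exists_eExpLNorm_sub_dyadicE_le_of_two_le (𝕜 := 𝕜) (le_max_right ν 2) hγ
  exact ⟨K, hK, fun f hfi A hA hf N =>
    (eExpLNorm_mono hν (le_max_left ν 2) _).trans (h f hfi A hA hf N)⟩

lemma eExpLNorm_le_of_bound {ν B : ℝ} (hν : 0 < ν) {f : UnitAddCircle → 𝕜}
    (h : ∀ x, ‖f x‖ ≤ B) : eExpLNorm ν f ≤ ENNReal.ofReal B := by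
  refine iSup₂_le fun p hp => ?_
  have h1 : ENNReal.ofReal (p ^ (-1 / ν)) ≤ 1 := by
    rw [ENNReal.ofReal_le_one]
    refine Real.rpow_le_one_of_one_le_of_nonpos hp ?_
    rw [neg_div, neg_nonpos]
    positivity
  calc _ ≤ 1 * ENNReal.ofReal B := mul_le_mul' h1 (eLpNorm_le_of_bound_of_probability h)
    _ = _ := one_mul _

end DyadicTails

section Completeness

/-! ### Completeness of `exp L^ν` -/

variable {𝕜 : Type*} [RCLike 𝕜]

/-- Lower semicontinuity under `L¹` convergence: Fatou's lemma for each `p` along an almost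
everywhere convergent subsequence. -/
lemma eExpLNorm_le_of_tendsto {ν : ℝ} {v : ℕ → L1Torus 𝕜} {g : L1Torus 𝕜} {B : ℝ≥0∞}
    (hv : Filter.Tendsto v Filter.atTop (nhds g))
    (hB : ∀ᶠ m in Filter.atTop, eExpLNorm ν (v m) ≤ B) : eExpLNorm ν g ≤ B := by
  obtain ⟨ns, hns, hae⟩ := (tendstoInMeasure_of_tendsto_Lp hv).exists_seq_tendsto_ae
  refine iSup₂_le fun p hp => ?_
  have hc0 : ENNReal.ofReal (p ^ (-1 / ν)) ≠ 0 := by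
    rw [Ne, ENNReal.ofReal_eq_zero, not_le]
    positivity
  rw [ENNReal.mul_le_iff_le_inv hc0 ENNReal.ofReal_ne_top]
  refine (Lp.eLpNorm_lim_le_liminf_eLpNorm (fun n => Lp.aestronglyMeasurable (v (ns n))) _
    hae).trans ?_
  refine (Filter.liminf_le_liminf (v := fun _ => (ENNReal.ofReal (p ^ (-1 / ν)))⁻¹ * B)
    ?_).trans_eq (Filter.liminf_const _)
  filter_upwards [hns.tendsto_atTop.eventually hB] with n hn
  rw [← ENNReal.mul_le_iff_le_inv hc0 ENNReal.ofReal_ne_top]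
  exact (le_iSup₂ (f := fun (p : ℝ) (_ : 1 ≤ p) =>
    ENNReal.ofReal (p ^ (-1 / ν)) * eLpNorm (v (ns n)) (ENNReal.ofReal p) volume) p hp).trans hn

lemma ExpL.eExpLNorm_eq {ν : ℝ} (f : ExpL 𝕜 ν) : eExpLNorm ν f.toL1 = ENNReal.ofReal ‖f‖ := by
  rw [ExpL.norm_def, ENNReal.ofReal_toReal f.eNorm_lt_top.ne]

lemma ExpL.norm_le_iff {ν : ℝ} (f : ExpL 𝕜 ν) {B : ℝ} (hB : 0 ≤ B) :
    ‖f‖ ≤ B ↔ eExpLNorm ν f.toL1 ≤ ENNReal.ofReal B := by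
  rw [ExpL.eExpLNorm_eq, ENNReal.ofReal_le_ofReal_iff hB]

lemma LGdyad.eLGdyadNorm_le {γ : ℝ} {f : LGdyad 𝕜 γ} {A : ℝ} (h : ‖f‖ ≤ A) :
    eLGdyadNorm γ f.toL1 ≤ ENNReal.ofReal A := by
  rw [LGdyad.norm_def] at h
  rw [← ENNReal.ofReal_toReal f.eNorm_lt_top.ne]
  exact ENNReal.ofReal_le_ofReal h

lemma ExpL.norm_toL1_le {ν : ℝ} (f : ExpL 𝕜 ν) : ‖f.toL1‖ ≤ ‖f‖ := by
  rw [Lp.norm_def, ExpL.norm_def]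
  exact ENNReal.toReal_mono f.eNorm_lt_top.ne (eLpNorm_one_le_eExpLNorm ν _)

/-- A Cauchy sequence has an `L¹` limit; lower semicontinuity transfers the Cauchy estimates to the
differences from that limit. -/
instance ExpL.instCompleteSpace (ν : ℝ) : CompleteSpace (ExpL 𝕜 ν) := by
  refine Metric.complete_of_cauchySeq_tendsto fun u hu => ?_
  have hL1 : CauchySeq fun n => (u n).toL1 := by
    rw [Metric.cauchySeq_iff] at hu ⊢
    intro ε hε
    obtain ⟨n, hn⟩ := hu ε hε
    refine ⟨n, fun k hk l hl => lt_of_le_of_lt ?_ (hn k hk l hl)⟩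
    rw [dist_eq_norm, dist_eq_norm, ← map_sub]
    exact ExpL.norm_toL1_le _
  obtain ⟨g, hg⟩ := cauchySeq_tendsto_of_complete hL1
  have key : ∀ ε : ℝ, 0 < ε → ∃ n, ∀ k ≥ n,
      eExpLNorm ν ((u k).toL1 - g : L1Torus 𝕜) ≤ ENNReal.ofReal ε := by
    intro ε hε
    obtain ⟨n, hn⟩ := Metric.cauchySeq_iff.1 hu ε hε
    refine ⟨n, fun k hk => eExpLNorm_le_of_tendsto (hg.const_sub _) ?_⟩
    filter_upwards [Filter.eventually_ge_atTop n] with l hl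
    have := (hn k hk l hl).le
    rw [dist_eq_norm] at this
    rw [← map_sub]
    exact (ExpL.norm_le_iff _ hε.le).1 this
  obtain ⟨n, hn⟩ := key 1 one_pos
  have hmem : g ∈ expLSubmodule 𝕜 ν := by
    have h1 : (u n).toL1 ∈ expLSubmodule 𝕜 ν := (u n).eNorm_lt_top
    have h2 : (u n).toL1 - g ∈ expLSubmodule 𝕜 ν := (hn n le_rfl).trans_lt ENNReal.ofReal_lt_top
    simpa using sub_mem h1 h2
  set G : ExpL 𝕜 ν := (⟨g, hmem⟩ : expLSubmodule 𝕜 ν)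
  have hG : G.toL1 = g := rfl
  refine ⟨G, Metric.tendsto_atTop.2 fun ε hε => ?_⟩
  obtain ⟨m, hm⟩ := key (ε / 2) (by positivity)
  refine ⟨m, fun k hk => lt_of_le_of_lt ?_ (half_lt_self hε)⟩
  rw [dist_eq_norm, ExpL.norm_le_iff _ (by positivity), map_sub, hG]
  exact hm k hk

end Completeness

section Embedding

/-! ### The embedding and its coverings -/

variable {𝕜 : Type*} [RCLike 𝕜]

lemma exists_eExpLNorm_le {γ ν : ℝ} (hν : 0 < ν) (hγ : 1 - 1 / max ν 2 < γ) :
    ∃ K : ℝ, 0 < K ∧ ∀ (f : L1Torus 𝕜) (A B : ℝ) (N : ℕ), 0 < A → 0 ≤ B →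
      eLGdyadNorm γ f ≤ ENNReal.ofReal A → (∀ x, ‖dyadicE N f x‖ ≤ B) →
        eExpLNorm ν f ≤ ENNReal.ofReal (A * K * ((N : ℝ) + 1) ^ (1 - γ - 1 / max ν 2) + B) := by
  obtain ⟨K, hK, h⟩ := exists_eExpLNorm_sub_dyadicE_le (𝕜 := 𝕜) hν hγ
  refine ⟨K, hK, fun f A B N hA hB hf hE => ?_⟩
  have h1 := h f (L1.integrable_coeFn f) A hA hf N
  have h2 := eExpLNorm_le_of_bound hν hE
  rw [ENNReal.ofReal_add (by positivity) hB]
  refine le_trans (iSup₂_le fun p hp => ?_) (add_le_add h1 h2)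
  refine le_trans ?_ (add_le_add (le_iSup₂ p hp) (le_iSup₂ p hp))
  rw [← mul_add]
  gcongr
  refine le_trans (le_of_eq ?_) (eLpNorm_add_le ?_ ?_ (by simpa using hp))
  · congr 1
    funext x
    simp
  · exact (Lp.aestronglyMeasurable f).sub (measurable_dyadicE f _).aestronglyMeasurable
  · exact (measurable_dyadicE f _).aestronglyMeasurable

/-- Each of the at most `N+1` differences is bounded by `A`. This crude bound suffices, since it
only affects the number of codes. -/
lemma norm_dyadicE_le {γ A : ℝ} {f : UnitAddCircle → 𝕜}
    (hf : eLGdyadNorm γ f ≤ ENNReal.ofReal A) (hA : 0 ≤ A) (hγ : 0 ≤ γ) (N : ℕ)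
    (x : UnitAddCircle) : ‖dyadicE N f x‖ ≤ A * ((N : ℝ) + 1) := by
  have h0 : ‖dyadicE 0 f x‖ ≤ A := by
    have hx : dyadicIndex 0 x = 0 := by simpa using dyadicIndex_lt 0 x
    rw [dyadicE_eq_dyadicAvg, hx]
    exact norm_dyadicAvg_zero_le hf hA
  have h1 := norm_dyadicE_sub_le hf hA 0 N x
  rw [zero_add] at h1
  have h2 : ∑ i ∈ Finset.range N, (((0 : ℕ) : ℝ) + i + 2) ^ (-γ) ≤ N := by
    refine (Finset.sum_le_card_nsmul _ _ 1 fun i _ => ?_).trans_eq (by simp)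
    refine Real.rpow_le_one_of_one_le_of_nonpos ?_ (by linarith)
    push_cast
    linarith [(Nat.cast_nonneg i : (0 : ℝ) ≤ i)]
  have h3 := mul_le_mul_of_nonneg_left h2 hA
  have h4 := norm_sub_norm_le (dyadicE N f x) (dyadicE 0 f x)
  linarith

lemma dyadicE_sub (f g : L1Torus 𝕜) (k : ℕ) (x : UnitAddCircle) :
    dyadicE k (f - g : L1Torus 𝕜) x = dyadicE k f x - dyadicE k g x := by
  have e : ((f - g : L1Torus 𝕜) : UnitAddCircle → 𝕜) =ᵐ[volume]
      (f : UnitAddCircle → 𝕜) + (-1 : 𝕜) • (g : UnitAddCircle → 𝕜) := by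
    filter_upwards [Lp.coeFn_sub f g] with x hx
    rw [hx]
    simp [sub_eq_add_neg]
  rw [dyadicE_congr e, dyadicE_add (L1.integrable_coeFn f) ((L1.integrable_coeFn g).smul _),
    dyadicE_smul]
  simp [sub_eq_add_neg]

lemma exists_embedding {γ ν : ℝ} (hν : 0 < ν) (hγ : 1 - 1 / max ν 2 < γ) :
    ∃ ι : LGdyad 𝕜 γ →L[𝕜] ExpL 𝕜 ν, ∀ f : LGdyad 𝕜 γ, (ι f).toL1 = f.toL1 := by
  have hγ0 : 0 ≤ γ := by
    have : 1 / max ν 2 ≤ 1 / 2 := one_div_le_one_div_of_le (by norm_num) (le_max_right _ _)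
    linarith
  obtain ⟨K, hK, h⟩ := exists_eExpLNorm_le (𝕜 := 𝕜) hν hγ
  have hbd : ∀ (f : LGdyad 𝕜 γ) (A : ℝ), 0 < A → ‖f‖ ≤ A →
      eExpLNorm ν f.toL1 ≤ ENNReal.ofReal ((K + 1) * A) := by
    intro f A hA hfA
    have hf := LGdyad.eLGdyadNorm_le hfA
    refine (h f.toL1 A A 0 hA hA.le hf fun x => ?_).trans (ENNReal.ofReal_le_ofReal ?_)
    · simpa using norm_dyadicE_le hf hA.le hγ0 0 x
    · simp only [Nat.cast_zero, zero_add, Real.one_rpow]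
      linarith
  have hmem : ∀ f : LGdyad 𝕜 γ, f.toL1 ∈ expLSubmodule 𝕜 ν := fun f =>
    (hbd f (‖f‖ + 1) (by positivity) (by linarith)).trans_lt ENNReal.ofReal_lt_top
  let ι₀ : LGdyad 𝕜 γ →ₗ[𝕜] ExpL 𝕜 ν :=
    LinearMap.codRestrict (expLSubmodule 𝕜 ν) LGdyad.toL1 hmem
  refine ⟨ι₀.mkContinuous (K + 1) fun f => ?_, fun f => rfl⟩
  -- `hbd` needs a positive radius while `‖f‖` may vanish, so `‖f‖ + ε/(K+1)` is used and `ε` is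
  -- arbitrary.
  refine le_of_forall_pos_le_add fun ε hε => ?_
  have hK1 : 0 < K + 1 := by positivity
  have := hbd f (‖f‖ + ε / (K + 1)) (by positivity) (by linarith [div_pos hε hK1])
  rw [mul_add, mul_div_cancel₀ _ hK1.ne'] at this
  exact (ExpL.norm_le_iff (ι₀ f) (by positivity)).2 this

/-! ### Discretization of the averages and the covering -/

/-- Rounding on a grid of mesh `2^(-N)`. As `N+1 ≤ 2^N`, the shifted and scaled value is at most
`2·4^N < 2^(2N+2)`; the reduction modulo `2^(2N+2)` is harmless on the range considered. -/
lemma exists_code_real (N : ℕ) : ∃ code : ℝ → Fin (2 ^ (2 * N + 2)), ∀ x y : ℝ,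
    |x| ≤ (N : ℝ) + 1 → |y| ≤ (N : ℝ) + 1 → code x = code y → |x - y| ≤ (2 ^ N)⁻¹ := by
  have h2 : (0 : ℝ) < 2 ^ N := by positivity
  let g : ℝ → ℕ := fun x => ⌊(x + (N + 1)) * 2 ^ N⌋₊
  have hg : ∀ x : ℝ, |x| ≤ (N : ℝ) + 1 → g x < 2 ^ (2 * N + 2) := by
    intro x hx
    have hx' := abs_le.1 hx
    have h0 : 0 ≤ (x + (N + 1)) * 2 ^ N := mul_nonneg (by linarith) h2.le
    have hN : ((N : ℝ) + 1) ≤ 2 ^ N := by exact_mod_cast Nat.lt_two_pow_self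
    rw [Nat.floor_lt h0]
    push_cast
    rw [pow_add, pow_mul', pow_two]
    nlinarith
  refine ⟨fun x => Fin.ofNat _ (g x), fun x y hx hy hxy => ?_⟩
  have hgxy : g x = g y := by
    have := congrArg Fin.val hxy
    simpa [Fin.ofNat, Nat.mod_eq_of_lt (hg x hx), Nat.mod_eq_of_lt (hg y hy)] using this
  have hx0 : 0 ≤ (x + (N + 1)) * 2 ^ N := mul_nonneg (by linarith [abs_le.1 hx]) h2.le
  have hy0 : 0 ≤ (y + (N + 1)) * 2 ^ N := mul_nonneg (by linarith [abs_le.1 hy]) h2.le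
  have hx1 := Nat.floor_le hx0
  have hx2 := Nat.lt_floor_add_one ((x + (N + 1)) * 2 ^ N)
  have hy1 := Nat.floor_le hy0
  have hy2 := Nat.lt_floor_add_one ((y + (N + 1)) * 2 ^ N)
  have e : ((⌊(x + (N + 1)) * 2 ^ N⌋₊ : ℕ) : ℝ) = (⌊(y + (N + 1)) * 2 ^ N⌋₊ : ℕ) := by
    exact congrArg Nat.cast hgxy
  rw [e] at hx1 hx2
  have habs : |x - y| * 2 ^ N = |(x - y) * 2 ^ N| := by rw [abs_mul, abs_of_pos h2]
  rw [← one_div, le_div_iff₀ h2, habs, abs_le]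
  constructor <;> linarith

lemma exists_code (N : ℕ) :
    ∃ code : 𝕜 → Fin (2 ^ (2 * N + 2)) × Fin (2 ^ (2 * N + 2)), ∀ z w : 𝕜,
      ‖z‖ ≤ (N : ℝ) + 1 → ‖w‖ ≤ (N : ℝ) + 1 → code z = code w → ‖z - w‖ ≤ 2 * (2 ^ N)⁻¹ := by
  obtain ⟨code, h⟩ := exists_code_real N
  refine ⟨fun z => (code (RCLike.re z), code (RCLike.im z)), fun z w hz hw hzw => ?_⟩
  have h1 := h _ _ ((RCLike.abs_re_le_norm z).trans hz) ((RCLike.abs_re_le_norm w).trans hw)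
    (congrArg Prod.fst hzw)
  have h2 := h _ _ ((RCLike.abs_im_le_norm z).trans hz) ((RCLike.abs_im_le_norm w).trans hw)
    (congrArg Prod.snd hzw)
  rw [← map_sub] at h1 h2
  linarith [norm_le_abs_re_add_abs_im (z - w)]

/-- Centres are chosen inside `S`, one for each code attained there. In the application, differences
from a centre then stay in twice the unit ball, where the tail estimate is available. -/
lemma exists_representatives {Y α : Type*} [Nonempty Y] [Fintype α] (S : Set Y) (φ : Y → α)
    {M : ℕ} (hM : Fintype.card α ≤ M) :
    ∃ c : Fin M → Y, ∀ y ∈ S, ∃ i, c i ∈ S ∧ φ (c i) = φ y := by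
  classical
  obtain ⟨e⟩ : Nonempty (α ↪ Fin M) :=
    Function.Embedding.nonempty_of_card_le (by simpa using hM)
  refine ⟨fun i => if h : ∃ y ∈ S, e (φ y) = i then h.choose else Classical.arbitrary Y,
    fun y hy => ⟨e (φ y), ?_⟩⟩
  have h : ∃ y' ∈ S, e (φ y') = e (φ y) := ⟨y, hy, rfl⟩
  simp only [dif_pos h]
  exact ⟨h.choose_spec.1, e.injective h.choose_spec.2⟩

lemma exists_cover {γ ν : ℝ} (hν : 0 < ν) (hγ : 1 - 1 / max ν 2 < γ)
    (ι : LGdyad 𝕜 γ →L[𝕜] ExpL 𝕜 ν) (hι : ∀ f : LGdyad 𝕜 γ, (ι f).toL1 = f.toL1) :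
    ∃ C : ℝ, 0 < C ∧ ∀ N M : ℕ, 2 ^ (4 * 4 ^ N) ≤ M → ∃ c : Fin M → ExpL 𝕜 ν,
      ∀ y : LGdyad 𝕜 γ, ‖y‖ ≤ 1 → ∃ i,
        ι y ∈ Metric.closedBall (c i) (C * ((N : ℝ) + 1) ^ (1 - γ - 1 / max ν 2)) := by
  have hγ0 : 0 ≤ γ := by
    have : 1 / max ν 2 ≤ 1 / 2 := one_div_le_one_div_of_le (by norm_num) (le_max_right _ _)
    linarith
  obtain ⟨K, hK, h⟩ := exists_eExpLNorm_le (𝕜 := 𝕜) hν hγ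
  set a := γ - 1 + 1 / max ν 2 with ha
  have ha0 : 0 < a := by linarith
  have hexp : 1 - γ - 1 / max ν 2 = -a := by rw [ha]; ring
  rw [hexp] at h ⊢
  have hlog : 0 < Real.log 2 := Real.log_pos (by norm_num)
  -- The constant in `(N+1)^a ≤ K' 2^(N+1)`. Below, `2K` comes from the tail of a difference of norm
  -- at most `2`, and `4K'` from the rounding error `2·2^(-N)`.
  set K' := (a / Real.log 2) ^ a
  refine ⟨2 * K + 4 * K', by positivity, fun N M hM => ?_⟩
  have hN : (0 : ℝ) < (N : ℝ) + 1 := by positivity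
  obtain ⟨code, hcode⟩ := exists_code (𝕜 := 𝕜) N
  let φ : LGdyad 𝕜 γ → Fin (2 ^ N) → Fin (2 ^ (2 * N + 2)) × Fin (2 ^ (2 * N + 2)) :=
    fun y m => code (dyadicAvg y.toL1 N m)
  have hcard : Fintype.card (Fin (2 ^ N) → Fin (2 ^ (2 * N + 2)) × Fin (2 ^ (2 * N + 2))) ≤ M := by
    refine le_trans ?_ hM
    simp only [Fintype.card_fun, Fintype.card_prod, Fintype.card_fin]
    rw [← pow_add, ← pow_mul]
    refine Nat.pow_le_pow_right (by norm_num) ?_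
    -- There are `2^N` averages with `4N+4` bits each, that is, at most `4·4^N` bits in all.
    have h1 : N + 1 ≤ 2 ^ N := Nat.lt_two_pow_self
    calc (2 * N + 2 + (2 * N + 2)) * 2 ^ N = 4 * ((N + 1) * 2 ^ N) := by ring
      _ ≤ 4 * (2 ^ N * 2 ^ N) := by gcongr
      _ = 4 * 4 ^ N := by rw [← mul_pow]; norm_num
  obtain ⟨c, hc⟩ := exists_representatives {y : LGdyad 𝕜 γ | ‖y‖ ≤ 1} φ hcard
  refine ⟨fun i => ι (c i), fun y hy => ?_⟩
  obtain ⟨i, hci, hφ⟩ := hc y hy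
  refine ⟨i, ?_⟩
  have hci : ‖c i‖ ≤ 1 := hci
  have hsub : ‖y - c i‖ ≤ 2 := (norm_sub_le _ _).trans (by linarith)
  have hE : ∀ x, ‖dyadicE N (y - c i).toL1 x‖ ≤ 2 * (2 ^ N)⁻¹ := by
    intro x
    have hx := congrFun hφ ⟨dyadicIndex N x, dyadicIndex_lt N x⟩
    simp only [φ, ← dyadicE_eq_dyadicAvg] at hx
    rw [map_sub, dyadicE_sub]
    refine hcode _ _ ?_ ?_ hx.symm
    · simpa using norm_dyadicE_le (LGdyad.eLGdyadNorm_le hy) zero_le_one hγ0 N x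
    · simpa using norm_dyadicE_le (LGdyad.eLGdyadNorm_le hci) zero_le_one hγ0 N x
  have hfin := h (y - c i).toL1 2 _ N (by norm_num) (by positivity)
    (LGdyad.eLGdyadNorm_le hsub) hE
  rw [Metric.mem_closedBall, dist_eq_norm, ← map_sub, ExpL.norm_le_iff _ (by positivity), hι]
  refine hfin.trans (ENNReal.ofReal_le_ofReal ?_)
  have hpow : ((2 : ℝ) ^ N)⁻¹ ≤ 2 * K' * ((N : ℝ) + 1) ^ (-a) := by
    have h1 := rpow_le_rpow_mul_exp (x := (N : ℝ) + 1) hN.le hlog ha0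
    have h2 : Real.exp (Real.log 2 * ((N : ℝ) + 1)) = 2 ^ N * 2 := by
      rw [Real.exp_mul, Real.exp_log (by norm_num), ← pow_succ]
      exact_mod_cast Real.rpow_natCast 2 (N + 1)
    rw [h2] at h1
    rw [Real.rpow_neg hN.le, ← div_eq_mul_inv, le_div_iff₀ (by positivity), inv_mul_eq_div,
      div_le_iff₀ (by positivity)]
    linarith
  linarith

/-! ### From coverings to compactness and entropy numbers -/

lemma isCompactOperator_of_covers {Y X : Type*} [SeminormedAddCommGroup Y] [NormedSpace 𝕜 Y]
    [NormedAddCommGroup X] [NormedSpace 𝕜 X] [CompleteSpace X] (ι : Y →L[𝕜] X)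
    (h : ∀ ε : ℝ, 0 < ε → ∃ (M : ℕ) (c : Fin M → X), ∀ y : Y, ‖y‖ ≤ 1 →
      ∃ i, ι y ∈ Metric.closedBall (c i) ε) : IsCompactOperator ι := by
  have htb : TotallyBounded (ι '' Metric.closedBall 0 1) := by
    refine Metric.totallyBounded_iff.2 fun ε hε => ?_
    obtain ⟨M, c, hc⟩ := h (ε / 2) (by positivity)
    refine ⟨Set.range c, Set.finite_range c, ?_⟩
    rintro _ ⟨y, hy, rfl⟩
    obtain ⟨i, hi⟩ := hc y (by simpa using hy)
    simp only [Set.mem_range, Set.iUnion_exists, Set.iUnion_iUnion_eq', Set.mem_iUnion]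
    exact ⟨i, Metric.closedBall_subset_ball (half_lt_self hε) hi⟩
  refine ⟨closure (ι '' Metric.closedBall 0 1), htb.closure.isCompact_of_isClosed isClosed_closure,
    ?_⟩
  refine Filter.mem_of_superset (Metric.closedBall_mem_nhds 0 one_pos) fun y hy => ?_
  exact subset_closure ⟨y, hy, rfl⟩

lemma entropyNumber_le {Y X : Type*} [SeminormedAddCommGroup Y] [SeminormedAddCommGroup X]
    {ι : Y → X} {n : ℕ} {ε : ℝ} (hε : 0 < ε)
    (h : ∃ c : Fin (2 ^ (n - 1)) → X, ∀ y : Y, ‖y‖ ≤ 1 → ∃ i, ι y ∈ Metric.closedBall (c i) ε) :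
    entropyNumber ι n ≤ ENNReal.ofReal ε :=
  iInf_le_of_le ε (iInf_le_of_le hε (iInf_le_of_le h le_rfl))

/-- For `n ≥ 5`, choosing `4^(N+1) ≤ n-1 < 4^(N+2)` allows the covering of level `N` and gives `log
n ≤ 2 log 4 · (N+1)`. -/
lemma exists_entropyNumber_le_log_rpow {Y X : Type*} [SeminormedAddCommGroup Y] [NormedSpace 𝕜 Y]
    [NormedAddCommGroup X] [NormedSpace 𝕜 X] (ι : Y →L[𝕜] X) {a C : ℝ} (ha : 0 < a) (hC : 0 < C)
    (h : ∀ N M : ℕ, 2 ^ (4 * 4 ^ N) ≤ M → ∃ c : Fin M → X, ∀ y : Y, ‖y‖ ≤ 1 →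
      ∃ i, ι y ∈ Metric.closedBall (c i) (C * ((N : ℝ) + 1) ^ (-a))) :
    ∃ C' : ℝ, 0 < C' ∧ ∀ n : ℕ, 2 ≤ n →
      entropyNumber ι n ≤ ENNReal.ofReal (C' * Real.log n ^ (-a)) := by
  have hlog4 : 0 < Real.log 4 := Real.log_pos (by norm_num)
  -- The summand `‖ι‖` covers `n ≤ 4`, where no level `N` is available and balls about `0` are used.
  set D := (C + ‖ι‖) * (2 * Real.log 4) ^ a
  have hD : 0 < D := by positivity
  refine ⟨D, hD, fun n hn => ?_⟩
  have hn1 : (1 : ℝ) < n := by exact_mod_cast hn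
  have hlog : 0 < Real.log n := Real.log_pos hn1
  have hcmp : ∀ N : ℕ, n ≤ 4 ^ (N + 2) →
      (C + ‖ι‖) * ((N : ℝ) + 1) ^ (-a) ≤ D * Real.log n ^ (-a) := by
    intro N hnN
    have hN : (0 : ℝ) < (N : ℝ) + 1 := by positivity
    have h1 : Real.log n ≤ 2 * Real.log 4 * ((N : ℝ) + 1) := by
      have : Real.log n ≤ Real.log ((4 : ℝ) ^ (N + 2)) :=
        Real.log_le_log (by linarith) (by exact_mod_cast hnN)
      rw [Real.log_pow] at this
      push_cast at this
      nlinarith [(Nat.cast_nonneg N : (0 : ℝ) ≤ N)]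
    have h2 : (2 * Real.log 4 * ((N : ℝ) + 1)) ^ (-a) ≤ Real.log n ^ (-a) :=
      Real.rpow_le_rpow_of_nonpos hlog h1 (by linarith)
    calc _ = D * (2 * Real.log 4 * ((N : ℝ) + 1)) ^ (-a) := by
          simp only [D]
          rw [Real.mul_rpow (by positivity) hN.le, Real.rpow_neg (x := 2 * Real.log 4)
            (by positivity)]
          field_simp
      _ ≤ _ := by gcongr
  refine entropyNumber_le (by positivity) ?_
  rcases lt_or_ge (n - 1) 4 with h4 | h4
  · refine ⟨fun _ => 0, fun y hy => ⟨⟨0, by positivity⟩, ?_⟩⟩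
    rw [Metric.mem_closedBall, dist_zero_right]
    have h1 := hcmp 0 (by omega)
    simp only [Nat.cast_zero, zero_add, Real.one_rpow, mul_one] at h1
    have h2 : ‖ι y‖ ≤ ‖ι‖ := (ι.le_opNorm y).trans (mul_le_of_le_one_right (norm_nonneg _) hy)
    linarith
  · obtain ⟨N, hN⟩ : ∃ N, Nat.log 4 (n - 1) = N + 1 :=
      Nat.exists_eq_succ_of_ne_zero (Nat.log_pos (by norm_num) h4).ne'
    have hle : 4 * 4 ^ N ≤ n - 1 := by
      rw [← pow_succ', ← hN]
      exact Nat.pow_log_le_self 4 (by omega)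
    have hlt : n ≤ 4 ^ (N + 2) := by
      have := Nat.lt_pow_succ_log_self (b := 4) (by norm_num) (n - 1)
      rw [hN] at this
      have e : N + 1 + 1 = N + 2 := rfl
      simp only [Nat.succ_eq_add_one, e] at this
      omega
    obtain ⟨c, hc⟩ := h N (2 ^ (n - 1)) (Nat.pow_le_pow_right (by norm_num) hle)
    refine ⟨c, fun y hy => ?_⟩
    obtain ⟨i, hi⟩ := hc y hy
    refine ⟨i, Metric.closedBall_subset_closedBall (le_trans ?_ (hcmp N hlt)) hi⟩
    gcongr
    linarith [norm_nonneg ι]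

end Embedding

end

theorem proposition3p4 (𝕜 : Type*) [RCLike 𝕜] (γ ν : ℝ) (hν : 0 < ν)
    (h : (1 / 2 < γ ∧ ν < 2) ∨ (2 ≤ ν ∧ 1 - 1 / ν < γ)) :
    ∃ ι : LGdyad 𝕜 γ →L[𝕜] ExpL 𝕜 ν,
      (∀ f : LGdyad 𝕜 γ, (ι f).toL1 = f.toL1) ∧
      IsCompactOperator ι ∧
      (1 / 2 < γ → ν ≤ 2 → ∃ C : ℝ, 0 < C ∧ ∀ n : ℕ, 2 ≤ n →
        entropyNumber ι n ≤ ENNReal.ofReal (C * Real.log n ^ (1 / 2 - γ))) ∧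
      (1 - 1 / ν < γ → 2 ≤ ν → ∃ C : ℝ, 0 < C ∧ ∀ n : ℕ, 2 ≤ n →
        entropyNumber ι n ≤ ENNReal.ofReal (C * Real.log n ^ (1 - γ - 1 / ν))) := by
  -- Both alternatives of the hypothesis say exactly that the decay exponent `a` is positive.
  have hγ : 1 - 1 / max ν 2 < γ := by
    rcases h with ⟨h1, h2⟩ | ⟨h1, h2⟩
    · rw [max_eq_right h2.le]; linarith
    · rwa [max_eq_left h1]
  obtain ⟨ι, hι⟩ := exists_embedding (𝕜 := 𝕜) hν hγ
  obtain ⟨C, hC, hcov⟩ := exists_cover hν hγ ι hι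
  obtain ⟨a, ha⟩ : ∃ a, a = γ - 1 + 1 / max ν 2 := ⟨_, rfl⟩
  have ha0 : 0 < a := by linarith
  rw [show 1 - γ - 1 / max ν 2 = -a by rw [ha]; ring] at hcov
  have hent := exists_entropyNumber_le_log_rpow ι ha0 hC hcov
  refine ⟨ι, hι, isCompactOperator_of_covers ι fun ε hε => ?_, fun _ h2 => ?_, fun _ h2 => ?_⟩
  · have hlim : Filter.Tendsto (fun N : ℕ => C * ((N : ℝ) + 1) ^ (-a)) Filter.atTop (nhds 0) := by
      rw [← mul_zero C]
      exact ((tendsto_rpow_neg_atTop ha0).comp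
        (Filter.tendsto_atTop_add_const_right _ 1 tendsto_natCast_atTop_atTop)).const_mul C
    obtain ⟨N, hN⟩ := (hlim.eventually (gt_mem_nhds hε)).exists
    obtain ⟨c, hc⟩ := hcov N _ le_rfl
    refine ⟨_, c, fun y hy => ?_⟩
    obtain ⟨i, hi⟩ := hc y hy
    exact ⟨i, Metric.closedBall_subset_closedBall hN.le hi⟩
  · rw [max_eq_right h2] at ha
    rwa [show 1 / 2 - γ = -a by rw [ha]; ring]
  · rw [max_eq_left h2] at ha
    rwa [show 1 - γ - 1 / ν = -a by rw [ha]; ring]
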